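/- Let $T$ be a finite network without cycles embedded in $\mathbb{R}^d$ (a tree or, if $T$ is not connected, a disjoint union of trees): $T$ is the union of finitely many non-degenerate closed straight segments $e$ (edges) that meet only in common endpoints, and the underlying graph is acyclic. Write $|e|$ for the length of $e$. Let $s(e)\ge 0$ for every edge $e$, and let $\mu_T$ be a Borel probability measure on $\mathbb{R}^d$ that is supported on $T$ and satisfies $\mu_T(e)=|e|\,s(e)$ for every edge $e$. Let $1<p<\infty$. For finite Borel measures $\mu,\nu$ of equal mass let $W_p(\mu,\nu)=\left(\inf_\pi\int\int|a-b|^p\,\pi(da\,db)\right)^{1/p}$, the infimum being over all measures $\pi$ on $\mathbb{R}^d\times\mathbb{R}^d$ with marginals $\mu$ and $\nu$. For points $x,y$ put $$W_p(x,y\|\mu_T)=\lim_{\varepsilon\to 0^+}\varepsilon^{-1}\,W_p(\mu_T+\varepsilon\delta_x,\ \mu_T+\varepsilon\delta_y)\in[0,\infty].$$ Let $x,y$ be two points joined by a path in $T$ (for instance a source $x\in A$ and a target $y\in B$ that are vertices of the same component of $T$), and let $o_T(x,y)$ be the set of edges of the unique path in $T$ from $x$ to $y$. Then the limit defining $W_p(x,y\|\mu_T)$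 exists in $[0,\infty]$, and $$W_p^p(x,y\|\mu_T)\ \ge\ \sum_{e\in o_T(x,y)}|e|\,s(e)^{1-p},$$ with the convention $0^{1-p}=\infty$. If $\mu_T$ is uniform on each edge $e\in o_T(x,y)$ (that is, its restriction to $e$ is a constant multiple of arc length on $e$), then equality holds. Conversely, if $s(e)>0$ for every $e\in o_T(x,y)$ and equality holds, then $\mu_T$ is uniform on each edge $e\in o_T(x,y)$. -/

import Mathlib

open MeasureTheory Filter Topology
open scoped ENNReal NNReal

noncomputable section

namespace GilbertMailing

/-- `π` is a transport plan from `μ` to `ν`: its two marginals are `μ` and `ν`. -/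
def IsTransportPlan {X : Type*} [MeasurableSpace X] (μ ν : Measure X)
    (π : Measure (X × X)) : Prop :=
  π.map Prod.fst = μ ∧ π.map Prod.snd = ν

/-- The Wasserstein `p`-distance
`W_p(μ, ν) = (inf_π ∫∫ |a - b|^p dπ(a, b))^(1/p)`, the infimum being over all transport plans
from `μ` to `ν`. It is used for measures of equal finite mass, not necessarily of mass one. -/
def wasserstein {X : Type*} [MeasurableSpace X] [PseudoEMetricSpace X] (p : ℝ)
    (μ ν : Measure X) : ℝ≥0∞ :=
  (⨅ (π : Measure (X × X)) (_ : IsTransportPlan μ ν π), ∫⁻ z, edist z.1 z.2 ^ p ∂π) ^ (1 / p)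

/-- `W` is the conditional Wasserstein distance `W_p(ν₁, ν₂ ‖ μ)`, that is, the limit of
`ε⁻¹ W_p(μ + ε ν₁, μ + ε ν₂)` as `ε` tends to `0` from above exists in `[0, ∞]` and equals `W`. -/
def IsCondWasserstein {X : Type*} [MeasurableSpace X] [PseudoEMetricSpace X] (p : ℝ)
    (ν₁ ν₂ μ : Measure X) (W : ℝ≥0∞) : Prop :=
  Tendsto (fun ε : ℝ≥0 => (ε : ℝ≥0∞)⁻¹ * wasserstein p (μ + ε • ν₁) (μ + ε • ν₂))
    (𝓝[>] 0) (𝓝 W)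

/-- The closed straight segment spanned by an unordered pair of points of `ℝ^d`. -/
def edgeSegment {d : ℕ} (e : Sym2 (EuclideanSpace ℝ (Fin d))) :
    Set (EuclideanSpace ℝ (Fin d)) :=
  Sym2.lift ⟨fun u v => segment ℝ u v, fun u v => segment_symm ℝ u v⟩ e

/-- The Euclidean length `|e|`. -/
def edgeLength {d : ℕ} (e : Sym2 (EuclideanSpace ℝ (Fin d))) : ℝ≥0 :=
  Sym2.lift ⟨fun u v => nndist u v, fun u v => nndist_comm u v⟩ e

/-- A finite network without cycles (a tree or, if it is not connected, a disjoint union of trees)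
embedded in `ℝ^d`, with straight edges. The vertices are points of `ℝ^d`, there are finitely many
edges, and two different edges can only meet in a common endpoint. -/
structure TreeNetwork (d : ℕ) where
  /-- The combinatorial graph; points of `ℝ^d` that lie on no edge are isolated and play no role. -/
  graph : SimpleGraph (EuclideanSpace ℝ (Fin d))
  finite_edges : graph.edgeSet.Finite
  acyclic : graph.IsAcyclic
  embedded : ∀ e ∈ graph.edgeSet, ∀ f ∈ graph.edgeSet, e ≠ f →
    ∀ z ∈ edgeSegment e ∩ edgeSegment f, z ∈ e ∧ z ∈ f

/-- The subset of `ℝ^d` covered by the network, i.e. the union of its edges. -/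
def TreeNetwork.carrier {d : ℕ} (T : TreeNetwork d) : Set (EuclideanSpace ℝ (Fin d)) :=
  ⋃ e ∈ T.graph.edgeSet, edgeSegment e

/-- The orbit `o_T(x, y)`, viewed as a set of edges: the edges of the (by acyclicity unique) path
of `T` from `x` to `y`. -/
def TreeNetwork.orbit {d : ℕ} (T : TreeNetwork d) (x y : EuclideanSpace ℝ (Fin d)) :
    Set (Sym2 (EuclideanSpace ℝ (Fin d))) :=
  {e | ∃ q : T.graph.Walk x y, q.IsPath ∧ e ∈ q.edges}

/-- `μ` is uniform on the edge `e`: restricted to the segment `e`, it is a constant multiple of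
the arc-length measure (one-dimensional Hausdorff measure). -/
def IsUniformOnEdge {d : ℕ} (μ : Measure (EuclideanSpace ℝ (Fin d)))
    (e : Sym2 (EuclideanSpace ℝ (Fin d))) : Prop :=
  ∃ c : ℝ≥0, μ.restrict (edgeSegment e) = c • (Measure.hausdorffMeasure 1).restrict (edgeSegment e)

end GilbertMailing

end

/-! Write g(ε) = W_p(μ + εδ_x, μ + εδ_y). Passing through μ + aδ_y + bδ_x shows that g is
subadditive, and moving only the extra mass gives g(ε) → 0. Hence g(ε)/ε converges to its supremum
(`isCondWasserstein_dirac_iSup`).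

Lower bound: integrate a Lipschitz function φ against a plan and apply Hölder. A cheap plan makes
few long jumps, so only the local slope K of φ counts in the limit: |φ(x) - φ(y)| ≤ ‖K‖_{L^q(μ)} W
(`edist_le_lintegral_slope_mul`). In a tree, deleting an edge e of the path separates x from y, so
there is a potential that grows by |e| along e and is constant on every other edge
(`TreeNetwork.slopeSystem`). A combination with slope c_e on e yields ∑ c_e |e| ≤ (∑ c_e^q |e|
s(e))^{1/q} W, and c_e = s(e)^{1-p} is the optimal choice (`SlopeSystem.sum_len_mul_rpow_le`).

Equality for uniform mass: parametrize the path by the mass already passed and shift the parameter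
by ε. On e the speed is 1/s(e) during a time |e| s(e), so its p-th power integrates to |e|
s(e)^{1-p} (`IsQuantileCurve.wasserstein_le`, `exists_isQuantileCurve_of_path`).

Converse: cut an edge at distance l from one end. The lower bound for the finer system involves the
mean densities of the two parts, and by strict convexity it exceeds the old bound unless these
agree. So every initial piece whose cut point is not an atom carries mass l s(e), which forces
uniformity (`SlopeSystem.measure_inter_preimage_Iic_of_rpow_eq`,
`restrict_segment_eq_smul_hausdorffMeasure`). -/

noncomputable section

namespace GilbertMailing

open ProbabilityTheory

/-! ### Transport plans, the triangle inequality, and existence of the limit. -/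

section Transport

variable {X : Type*} [MeasurableSpace X]

lemma IsTransportPlan.univ_eq {μ ν : Measure X} {π : Measure (X × X)}
    (h : IsTransportPlan μ ν π) : π Set.univ = μ Set.univ := by
  rw [← h.1, Measure.map_apply measurable_fst MeasurableSet.univ, Set.preimage_univ]

lemma IsTransportPlan.isFiniteMeasure {μ ν : Measure X} [IsFiniteMeasure μ]
    {π : Measure (X × X)} (h : IsTransportPlan μ ν π) : IsFiniteMeasure π :=
  ⟨by rw [h.univ_eq]; exact measure_lt_top _ _⟩

lemma IsTransportPlan.add {μ ν μ' ν' : Measure X} {π π' : Measure (X × X)}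
    (h : IsTransportPlan μ ν π) (h' : IsTransportPlan μ' ν' π') :
    IsTransportPlan (μ + μ') (ν + ν') (π + π') :=
  ⟨by rw [Measure.map_add _ _ measurable_fst, h.1, h'.1],
   by rw [Measure.map_add _ _ measurable_snd, h.2, h'.2]⟩

lemma isTransportPlan_map {Ω : Type*} [MeasurableSpace Ω] (P : Measure Ω) {f g : Ω → X}
    (hf : Measurable f) (hg : Measurable g) :
    IsTransportPlan (P.map f) (P.map g) (P.map fun ω => (f ω, g ω)) :=
  ⟨by rw [Measure.map_map measurable_fst (hf.prodMk hg)]; rfl,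
   by rw [Measure.map_map measurable_snd (hf.prodMk hg)]; rfl⟩

lemma isTransportPlan_diag (μ : Measure X) :
    IsTransportPlan μ μ (μ.map fun a => (a, a)) := by
  simpa using isTransportPlan_map μ measurable_id measurable_id

/-- Two transport plans with a common marginal can be glued along it. -/
lemma IsTransportPlan.exists_gluing [StandardBorelSpace X] [Nonempty X] {μ ν ρ : Measure X}
    [IsFiniteMeasure μ] [IsFiniteMeasure ν] {π₁ π₂ : Measure (X × X)}
    (h₁ : IsTransportPlan μ ν π₁) (h₂ : IsTransportPlan ν ρ π₂) :
    ∃ γ : Measure (X × X × X), γ.map (fun w => (w.2.1, w.1)) = π₁ ∧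
      γ.map (fun w => (w.1, w.2.2)) = π₂ := by
  have := h₁.isFiniteMeasure
  have := h₂.isFiniteMeasure
  -- After the swap both plans have first marginal ν and can be disintegrated over it. The product
  -- of the two conditional kernels makes the outer coordinates independent given the middle one;
  -- `γ` lists the middle coordinate first.
  set ρ₁ := π₁.map Prod.swap with hρ₁
  have hfst₁ : ρ₁.fst = ν := by
    rw [Measure.fst, hρ₁, Measure.map_map measurable_fst measurable_swap]; exact h₁.2
  have hfst₂ : π₂.fst = ν := h₂.1
  have e₁ : ν ⊗ₘ ρ₁.condKernel = ρ₁ := by rw [← hfst₁]; exact ρ₁.disintegrate _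
  have e₂ : ν ⊗ₘ π₂.condKernel = π₂ := by rw [← hfst₂]; exact π₂.disintegrate _
  have hk₁ : (ρ₁.condKernel ×ₖ π₂.condKernel).map Prod.fst = ρ₁.condKernel := by
    rw [← Kernel.fst_eq, Kernel.fst_prod]
  have hk₂ : (ρ₁.condKernel ×ₖ π₂.condKernel).map Prod.snd = π₂.condKernel := by
    rw [← Kernel.snd_eq, Kernel.snd_prod]
  refine ⟨ν ⊗ₘ (ρ₁.condKernel ×ₖ π₂.condKernel), ?_, ?_⟩
  · have h : (ν ⊗ₘ (ρ₁.condKernel ×ₖ π₂.condKernel)).map (Prod.map id Prod.fst) = ρ₁ := by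
      rw [← Measure.compProd_map measurable_fst, hk₁, e₁]
    have h' : π₁ = ρ₁.map Prod.swap := by
      rw [hρ₁, Measure.map_map measurable_swap measurable_swap]; simp
    refine Eq.trans ?_ ((congrArg (Measure.map Prod.swap) h).trans h'.symm)
    rw [Measure.map_map measurable_swap (measurable_id.prodMap measurable_fst)]
    rfl
  · conv_rhs => rw [← e₂, ← hk₂, Measure.compProd_map measurable_snd]
    rfl

lemma isTransportPlan_smul_dirac (ε : ℝ≥0) (x y : X) :
    IsTransportPlan (ε • Measure.dirac x) (ε • Measure.dirac y)
      (ε • Measure.dirac (x, y)) := by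
  constructor
  · rw [Measure.map_smul, Measure.map_dirac' measurable_fst]
  · rw [Measure.map_smul, Measure.map_dirac' measurable_snd]

variable [PseudoEMetricSpace X]

lemma wasserstein_le {p : ℝ} (hp : 0 < p) {μ ν : Measure X} {π : Measure (X × X)}
    (h : IsTransportPlan μ ν π) :
    wasserstein p μ ν ≤ (∫⁻ z, edist z.1 z.2 ^ p ∂π) ^ (1 / p) :=
  ENNReal.rpow_le_rpow (iInf₂_le π h) (by positivity)

lemma exists_plan_of_wasserstein_lt {p : ℝ} (hp : 0 < p) {μ ν : Measure X} {c : ℝ≥0∞}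
    (h : wasserstein p μ ν < c) :
    ∃ π, IsTransportPlan μ ν π ∧ (∫⁻ z, edist z.1 z.2 ^ p ∂π) ^ (1 / p) < c := by
  have h' : (⨅ (π : Measure (X × X)) (_ : IsTransportPlan μ ν π),
      ∫⁻ z, edist z.1 z.2 ^ p ∂π) < c ^ p := by
    rw [wasserstein] at h
    have := ENNReal.rpow_lt_rpow h hp
    rwa [← ENNReal.rpow_mul, one_div_mul_cancel hp.ne', ENNReal.rpow_one] at this
  obtain ⟨π, hπ⟩ := iInf_lt_iff.1 h'
  obtain ⟨hπ, hlt⟩ := iInf_lt_iff.1 hπ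
  refine ⟨π, hπ, ?_⟩
  have := ENNReal.rpow_lt_rpow hlt (z := 1 / p) (by positivity)
  rwa [← ENNReal.rpow_mul, mul_one_div_cancel hp.ne', ENNReal.rpow_one] at this

/-- Leaving the common mass ρ in place costs nothing. For p > 1 the inequality can be strict,
because a chain of short moves is cheaper than one long move. -/
lemma wasserstein_add_right_le [OpensMeasurableSpace X] [SecondCountableTopology X]
    {p : ℝ} (hp : 0 < p) (μ ν ρ : Measure X) :
    wasserstein p (μ + ρ) (ν + ρ) ≤ wasserstein p μ ν := by
  refine le_of_forall_gt fun c hc => ?_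
  obtain ⟨π, hπ, hlt⟩ := exists_plan_of_wasserstein_lt hp hc
  refine (wasserstein_le hp (hπ.add (isTransportPlan_diag ρ))).trans_lt ?_
  rw [lintegral_add_measure, lintegral_map (by fun_prop) (by fun_prop)]
  simpa [hp] using hlt

/-- Glue two nearly optimal plans and apply Minkowski's inequality in L^p of the glued measure. -/
lemma wasserstein_triangle [StandardBorelSpace X] [Nonempty X]
    [OpensMeasurableSpace X] [SecondCountableTopology X]
    {p : ℝ} (hp : 1 ≤ p) (μ ν ρ : Measure X) [IsFiniteMeasure μ] [IsFiniteMeasure ν] :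
    wasserstein p μ ρ ≤ wasserstein p μ ν + wasserstein p ν ρ := by
  have hp0 : 0 < p := by linarith
  by_cases ht₁ : wasserstein p μ ν = ⊤
  · simp [ht₁]
  by_cases ht₂ : wasserstein p ν ρ = ⊤
  · simp [ht₂]
  refine ENNReal.le_of_forall_pos_le_add fun ε hε _ => ?_
  have hε2 : ((ε / 2 : ℝ≥0) : ℝ≥0∞) ≠ 0 := by positivity
  obtain ⟨π₁, h₁, c₁⟩ := exists_plan_of_wasserstein_lt hp0 (ENNReal.lt_add_right ht₁ hε2)
  obtain ⟨π₂, h₂, c₂⟩ := exists_plan_of_wasserstein_lt hp0 (ENNReal.lt_add_right ht₂ hε2)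
  obtain ⟨γ, g₁, g₂⟩ := h₁.exists_gluing h₂
  have h₃ : IsTransportPlan μ ρ (γ.map fun w => (w.2.1, w.2.2)) := by
    have := isTransportPlan_map γ (f := fun w : X × X × X => w.2.1) (g := fun w => w.2.2)
      (by fun_prop) (by fun_prop)
    have e₁ : γ.map (fun w : X × X × X => w.2.1) = μ := by
      rw [← h₁.1, ← g₁, Measure.map_map measurable_fst (by fun_prop)]; rfl
    have e₂ : γ.map (fun w : X × X × X => w.2.2) = ρ := by
      rw [← h₂.2, ← g₂, Measure.map_map measurable_snd (by fun_prop)]; rfl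
    rwa [e₁, e₂] at this
  refine (wasserstein_le hp0 h₃).trans ?_
  rw [lintegral_map (by fun_prop) (by fun_prop)]
  rw [← g₁, lintegral_map (by fun_prop) (by fun_prop)] at c₁
  rw [← g₂, lintegral_map (by fun_prop) (by fun_prop)] at c₂
  calc (∫⁻ w, edist w.2.1 w.2.2 ^ p ∂γ) ^ (1 / p)
      ≤ (∫⁻ w, ((fun w : X × X × X => edist w.2.1 w.1) +
          fun w : X × X × X => edist w.1 w.2.2) w ^ p ∂γ) ^ (1 / p) := by
        gcongr with w
        exact edist_triangle _ _ _
    _ ≤ _ := ENNReal.lintegral_Lp_add_le (by fun_prop) (by fun_prop) hp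
    _ ≤ (wasserstein p μ ν + (ε / 2 : ℝ≥0)) + (wasserstein p ν ρ + (ε / 2 : ℝ≥0)) :=
        add_le_add c₁.le c₂.le
    _ = wasserstein p μ ν + wasserstein p ν ρ + ε := by
        rw [add_add_add_comm, ← ENNReal.coe_add, add_halves]

/-- A subadditive function on `[0, ∞)` that is continuous at `0` has a derivative at `0`. -/
lemma tendsto_inv_mul_of_subadditive {g : ℝ≥0 → ℝ≥0∞} (hadd : ∀ a b, g (a + b) ≤ g a + g b)
    (h0 : Tendsto g (𝓝 0) (𝓝 0)) :
    Tendsto (fun ε : ℝ≥0 => (ε : ℝ≥0∞)⁻¹ * g ε) (𝓝[>] 0)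
      (𝓝 (⨆ t : ℝ≥0, (t : ℝ≥0∞)⁻¹ * g t)) := by
  have hg0 : g 0 = 0 := by
    have := tendsto_nhds_unique (tendsto_pure_nhds g 0) (h0.mono_left (pure_le_nhds 0))
    exact this
  have hmul : ∀ (n : ℕ) a, g (n * a) ≤ n * g a := by
    intro n a
    induction n with
    | zero => simp [hg0]
    | succ n ih =>
      push_cast
      rw [add_mul, one_mul, add_mul, one_mul]
      exact (hadd _ _).trans (by gcongr)
  refine tendsto_order.2 ⟨fun c hc => ?_, fun c hc =>
    Eventually.of_forall fun ε => (le_iSup (fun t : ℝ≥0 => (t : ℝ≥0∞)⁻¹ * g t) ε).trans_lt hc⟩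
  obtain ⟨t, ht⟩ := lt_iSup_iff.1 hc
  -- At `t = 0` the quotient is `⊤ * 0 = 0`, so this index adds nothing to the supremum.
  have ht0 : t ≠ 0 := by
    rintro rfl
    simp [hg0] at ht
  have hct : c * t < g t := by
    rw [mul_comm, ← div_eq_mul_inv] at ht
    exact (ENNReal.lt_div_iff_mul_lt (by simp [ht0]) (by simp)).1 ht
  obtain ⟨δ, hδ, hδ'⟩ : ∃ δ > 0, ∀ r < δ, g r < g t - c * t := by
    have := (tendsto_order.1 h0).2 _ (tsub_pos_of_lt hct)
    obtain ⟨δ, hδ, h⟩ := Metric.eventually_nhds_iff.1 this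
    lift δ to ℝ≥0 using hδ.le
    exact ⟨δ, by simpa using hδ, fun r hr => h (by rw [NNReal.dist_eq]; simpa using hr)⟩
  have hev : ∀ᶠ ε : ℝ≥0 in 𝓝[>] 0, ε < δ :=
    eventually_nhdsWithin_of_eventually_nhds (Iio_mem_nhds hδ)
  filter_upwards [hev, self_mem_nhdsWithin] with ε hε hpos
  have hpos : 0 < ε := hpos
  -- Fekete's argument: t = nε + r with r < ε < δ, so g(t) ≤ n g(ε) + g(r), and the choice of δ
  -- makes g(r) smaller than the slack g(t) - ct.
  set n := ⌊t / ε⌋₊ with hn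
  have hnle : (n : ℝ≥0) * ε ≤ t := by
    have : (n : ℝ≥0) ≤ t / ε := Nat.floor_le (by positivity)
    exact (le_div_iff₀ hpos).1 this
  have hr : t - n * ε < ε := by
    have : t / ε < n + 1 := Nat.lt_floor_add_one _
    rw [div_lt_iff₀ hpos, add_mul, one_mul] at this
    rwa [tsub_lt_iff_left hnle]
  have h1 : g t ≤ n * g ε + g (t - n * ε) := by
    calc g t = g (n * ε + (t - n * ε)) := by rw [add_tsub_cancel_of_le hnle]
      _ ≤ _ := (hadd _ _).trans (by gcongr; exact hmul _ _)
  have h2 := hδ' _ (hr.trans hε)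
  have h3 : c * t < n * g ε := by
    by_contra hcon
    rw [not_lt] at hcon
    have : g t < c * t + (g t - c * t) :=
      h1.trans_lt (ENNReal.add_lt_add_of_le_of_lt
        (ne_top_of_le_ne_top (ne_top_of_lt hct) hcon) hcon h2)
    rw [add_tsub_cancel_of_le hct.le] at this
    exact lt_irrefl _ this
  have h4 : c * t < t * ((ε : ℝ≥0∞)⁻¹ * g ε) := by
    refine h3.trans_le ?_
    rw [← mul_assoc, ← ENNReal.coe_inv hpos.ne']
    gcongr
    rw [← ENNReal.coe_mul, ← div_eq_mul_inv]
    exact_mod_cast (le_div_iff₀ hpos).2 hnle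
  rw [mul_comm] at h4
  exact (ENNReal.mul_lt_mul_iff_right (by simpa using ht0) (by simp)).1 h4

/-- Having the limit as a supremum over all `t` means that an upper bound on the limit may be
checked for each `t` separately. -/
lemma isCondWasserstein_dirac_iSup {Y : Type*} [MeasurableSpace Y] [PseudoMetricSpace Y]
    [StandardBorelSpace Y] [OpensMeasurableSpace Y] [SecondCountableTopology Y]
    {p : ℝ} (hp : 1 ≤ p) (x y : Y) (μ : Measure Y) [IsFiniteMeasure μ] :
    IsCondWasserstein p (Measure.dirac x) (Measure.dirac y) μ
      (⨆ t : ℝ≥0, (t : ℝ≥0∞)⁻¹ *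
        wasserstein p (μ + t • Measure.dirac x) (μ + t • Measure.dirac y)) := by
  have hp0 : 0 < p := by linarith
  have : Nonempty Y := ⟨x⟩
  have hle : ∀ t : ℝ≥0, wasserstein p (μ + t • Measure.dirac x) (μ + t • Measure.dirac y)
      ≤ ((t : ℝ≥0∞) * edist x y ^ p) ^ (1 / p) := by
    intro t
    rw [add_comm μ, add_comm μ]
    refine (wasserstein_add_right_le hp0 _ _ _).trans
      ((wasserstein_le hp0 (isTransportPlan_smul_dirac t x y)).trans (le_of_eq ?_))
    rw [lintegral_smul_measure, lintegral_dirac' _ (by fun_prop)]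
    rfl
  refine tendsto_inv_mul_of_subadditive (fun a b => ?_) ?_
  · refine (wasserstein_triangle hp _ (μ + a • Measure.dirac y + b • Measure.dirac x) _).trans ?_
    rw [add_smul, add_smul, ← add_assoc, ← add_assoc]
    gcongr
    · exact wasserstein_add_right_le hp0 _ _ _
    · rw [add_right_comm, add_right_comm μ (a • Measure.dirac y)]
      exact wasserstein_add_right_le hp0 _ _ _
  · refine tendsto_of_tendsto_of_tendsto_of_le_of_le tendsto_const_nhds ?_
      (fun _ => zero_le) hle
    have h1 : Tendsto (fun t : ℝ≥0 => (t : ℝ≥0∞) * edist x y ^ p) (𝓝 0) (𝓝 0) := by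
      have : Tendsto (fun t : ℝ≥0 => (t : ℝ≥0∞) * edist x y ^ p) (𝓝 0)
          (𝓝 (((0 : ℝ≥0) : ℝ≥0∞) * edist x y ^ p)) :=
        ENNReal.Tendsto.mul_const (ENNReal.tendsto_coe.2 tendsto_id)
          (Or.inr (ENNReal.rpow_ne_top_of_nonneg hp0.le (edist_ne_top _ _)))
      simpa using this
    have := (ENNReal.continuous_rpow_const (y := 1 / p)).tendsto 0
    rw [ENNReal.zero_rpow_of_pos (by positivity)] at this
    exact this.comp h1

end Transport

/-! ### Lower bounds from test functions. -/

section Duality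

variable {X : Type*} [MeasurableSpace X] [MetricSpace X] [BorelSpace X]
  [SecondCountableTopology X]

/-- Testing a transport plan against a Lipschitz function, with a better slope bound for short
displacements starting in `A`. -/
lemma mul_edist_le_of_plan {μ : Measure X} [IsFiniteMeasure μ] {T : Set X}
    (hT : MeasurableSet T) (hμT : μ Tᶜ = 0) {x y : X} (hy : y ∈ T) {p q : ℝ}
    (hpq : p.HolderConjugate q) {φ : X → ℝ} {L : ℝ≥0} (hφ : LipschitzWith L φ)
    (hint : Integrable φ μ) {K : X → ℝ≥0∞} (hK : Measurable K) {A : Set X}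
    (hA : MeasurableSet A) {δ : ℝ≥0} (hδ : δ ≠ 0)
    (hloc : ∀ a ∈ A, ∀ b ∈ T, edist a b < δ → edist (φ a) (φ b) ≤ K a * edist a b)
    (ε : ℝ≥0) {π : Measure (X × X)}
    (hπ : IsTransportPlan (μ + ε • Measure.dirac x) (μ + ε • Measure.dirac y) π) :
    ε * edist (φ x) (φ y) ≤
      (∫⁻ a, K a ^ q ∂μ + ε * K x ^ q + (L : ℝ≥0∞) ^ q * (μ Aᶜ + ε)
        + (L : ℝ≥0∞) ^ q * (((δ : ℝ≥0∞) ^ p)⁻¹ * ∫⁻ z, edist z.1 z.2 ^ p ∂π)) ^ (1 / q)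
      * (∫⁻ z, edist z.1 z.2 ^ p ∂π) ^ (1 / p) := by
  have hq := hpq.symm.pos
  have hp := hpq.pos
  have := hπ.isFiniteMeasure
  have hcont := hφ.continuous
  have hmeas : Measurable φ := hcont.measurable
  have hid : ∀ z : X, Integrable φ (ε • Measure.dirac z) := fun z =>
    (integrable_dirac (by simp)).smul_measure_nnreal
  have hi : ∀ z : X, Integrable φ (μ + ε • Measure.dirac z) := fun z =>
    hint.add_measure (hid z)
  have hval : ∀ z : X, ∫ a, φ a ∂(μ + ε • Measure.dirac z) = ∫ a, φ a ∂μ + ε * φ z := by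
    intro z
    rw [integral_add_measure hint (hid z),
      integral_smul_nnreal_measure, integral_dirac' _ _ hmeas.stronglyMeasurable]
    rfl
  have hi1 : Integrable (fun z : X × X => φ z.1) π := by
    have := hi x
    rw [← hπ.1] at this
    exact (integrable_map_measure hmeas.aestronglyMeasurable measurable_fst.aemeasurable).1 this
  have hi2 : Integrable (fun z : X × X => φ z.2) π := by
    have := hi y
    rw [← hπ.2] at this
    exact (integrable_map_measure hmeas.aestronglyMeasurable measurable_snd.aemeasurable).1 this
  have hv1 : ∫ z : X × X, φ z.1 ∂π = ∫ a, φ a ∂μ + ε * φ x := by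
    rw [← hval x, ← hπ.1, integral_map measurable_fst.aemeasurable hmeas.aestronglyMeasurable]
  have hv2 : ∫ z : X × X, φ z.2 ∂π = ∫ a, φ a ∂μ + ε * φ y := by
    rw [← hval y, ← hπ.2, integral_map measurable_snd.aemeasurable hmeas.aestronglyMeasurable]
  -- The two marginals share μ, whose contribution cancels; what is left is ε(φ(x) - φ(y)).
  have step1 : ε * edist (φ x) (φ y) ≤ ∫⁻ z : X × X, edist (φ z.1) (φ z.2) ∂π := by
    have h1 : ε * edist (φ x) (φ y) = ‖∫ z : X × X, (φ z.1 - φ z.2) ∂π‖ₑ := by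
      rw [integral_sub hi1 hi2, hv1, hv2, add_sub_add_left_eq_sub, ← mul_sub, enorm_mul,
        edist_eq_enorm_sub]
      congr 1
      simp [enorm, NNReal.nnnorm_eq]
    rw [h1]
    refine (enorm_integral_le_lintegral_enorm _).trans (le_of_eq ?_)
    simp only [edist_eq_enorm_sub]
  set S : Set (X × X) := {z | z.1 ∈ A ∧ edist z.1 z.2 < δ} with hS
  have hSm : MeasurableSet S :=
    (measurable_fst hA).inter (measurableSet_lt (measurable_fst.edist measurable_snd)
      measurable_const)
  set k : X × X → ℝ≥0∞ := fun z =>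
    S.indicator (fun z => K z.1) z + Sᶜ.indicator (fun _ => (L : ℝ≥0∞)) z with hk
  have hkm : Measurable k :=
    ((hK.comp measurable_fst).indicator hSm).add (measurable_const.indicator hSm.compl)
  have haeT : ∀ᵐ z ∂π, z.2 ∈ T := by
    have h0 : (μ + ε • Measure.dirac y) Tᶜ = 0 := by
      simp [hμT, hT, hy]
    rw [← hπ.2, Measure.map_apply measurable_snd hT.compl] at h0
    exact h0
  have step2 : ∫⁻ z : X × X, edist (φ z.1) (φ z.2) ∂π ≤
      ∫⁻ z, (k * fun z : X × X => edist z.1 z.2) z ∂π := by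
    refine lintegral_mono_ae ?_
    filter_upwards [haeT] with z hz
    by_cases hzS : z ∈ S
    · simpa [hk, hzS] using hloc z.1 hzS.1 z.2 hz hzS.2
    · simpa [hk, hzS] using hφ z.1 z.2
  have step3 := ENNReal.lintegral_mul_le_Lp_mul_Lq π hpq.symm hkm.aemeasurable
    (g := fun z : X × X => edist z.1 z.2) (by fun_prop)
  refine step1.trans (step2.trans (step3.trans ?_))
  gcongr
  -- A pair outside `S` either starts outside `A` or moves by at least δ; in the second case 1 ≤
  -- δ^{-p} |a - b|^p, as in Markov's inequality.
  have hkq : ∀ z, k z ^ q ≤ K z.1 ^ q + (L : ℝ≥0∞) ^ q * (Aᶜ.indicator 1 z.1)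
      + (L : ℝ≥0∞) ^ q * (((δ : ℝ≥0∞) ^ p)⁻¹ * edist z.1 z.2 ^ p) := by
    intro z
    by_cases hzS : z ∈ S
    · simp only [hk, hzS, Set.indicator_of_mem, Set.mem_compl_iff, not_true_eq_false,
        not_false_eq_true, Set.indicator_of_notMem, add_zero]
      rw [add_assoc]
      exact le_self_add
    · simp only [hk, hzS, Set.indicator_of_mem, Set.mem_compl_iff,
        not_false_eq_true, Set.indicator_of_notMem, zero_add]
      by_cases hzA : z.1 ∈ A
      · have hge : (δ : ℝ≥0∞) ≤ edist z.1 z.2 := by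
          by_contra hcon
          exact hzS ⟨hzA, not_le.1 hcon⟩
        refine le_trans ?_ le_add_self
        have hδp : (δ : ℝ≥0∞) ^ p ≠ 0 := by simp [ENNReal.rpow_eq_zero_iff, hδ]
        have hδt : (δ : ℝ≥0∞) ^ p ≠ ⊤ := ENNReal.rpow_ne_top_of_nonneg hp.le (by simp)
        calc (L : ℝ≥0∞) ^ q = L ^ q * (((δ : ℝ≥0∞) ^ p)⁻¹ * δ ^ p) := by
              rw [ENNReal.inv_mul_cancel hδp hδt, mul_one]
          _ ≤ _ := by gcongr
      · refine le_trans ?_ le_self_add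
        refine le_trans ?_ le_add_self
        simp [hzA]
  have hL1 : ∀ f : X → ℝ≥0∞, Measurable f →
      ∫⁻ z : X × X, f z.1 ∂π = ∫⁻ a, f a ∂μ + ε * f x := by
    intro f hf
    rw [← lintegral_map hf measurable_fst, hπ.1, lintegral_add_measure, lintegral_smul_measure,
      lintegral_dirac' _ hf]
    rfl
  calc ∫⁻ z, k z ^ q ∂π
      ≤ ∫⁻ z, (K z.1 ^ q + (L : ℝ≥0∞) ^ q * (Aᶜ.indicator 1 z.1)
        + (L : ℝ≥0∞) ^ q * (((δ : ℝ≥0∞) ^ p)⁻¹ * edist z.1 z.2 ^ p)) ∂π :=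
        lintegral_mono hkq
    _ = (∫⁻ a, K a ^ q ∂μ + ε * K x ^ q)
        + (L : ℝ≥0∞) ^ q * (μ Aᶜ + ε * Aᶜ.indicator 1 x)
        + (L : ℝ≥0∞) ^ q * (((δ : ℝ≥0∞) ^ p)⁻¹ * ∫⁻ z, edist z.1 z.2 ^ p ∂π) := by
        have hind : Measurable (Aᶜ.indicator (1 : X → ℝ≥0∞)) :=
          measurable_one.indicator hA.compl
        rw [lintegral_add_right _ (by fun_prop), lintegral_add_right _ (by fun_prop),
          lintegral_const_mul _ (by fun_prop), lintegral_const_mul _ (by fun_prop),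
          lintegral_const_mul _ (by fun_prop), hL1 (fun a => K a ^ q) (by fun_prop),
          hL1 _ hind, lintegral_indicator_one hA.compl]
    _ ≤ _ := by
        gcongr
        refine mul_le_of_le_one_right' ?_
        by_cases hxA : x ∈ A <;> simp [hxA]

/-- **Duality bound**: a Lipschitz function whose slope at every point `a` of the support is at
most `K a` bounds the conditional Wasserstein distance from below. -/
theorem edist_le_lintegral_slope_mul {μ : Measure X} [IsFiniteMeasure μ] {T : Set X}
    (hT : MeasurableSet T) (hμT : μ Tᶜ = 0) {x y : X} (hy : y ∈ T) {p q : ℝ}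
    (hpq : p.HolderConjugate q) {φ : X → ℝ} {L : ℝ≥0} (hφ : LipschitzWith L φ)
    (hint : Integrable φ μ) {K : X → ℝ≥0∞} (hK : Measurable K) (hKtop : ∀ a, K a ≠ ⊤)
    (hKint : ∫⁻ a, K a ^ q ∂μ ≠ ⊤)
    (hloc : ∀ a ∈ T, ∀ᶠ b in 𝓝[T] a, edist (φ a) (φ b) ≤ K a * edist a b)
    {W : ℝ≥0∞} (hWtop : W ≠ ⊤)
    (hW : IsCondWasserstein p (Measure.dirac x) (Measure.dirac y) μ W) :
    edist (φ x) (φ y) ≤ (∫⁻ a, K a ^ q ∂μ) ^ (1 / q) * W := by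
  have hq := hpq.symm.pos
  have hp := hpq.pos
  have hmeas : Measurable φ := hφ.continuous.measurable
  obtain ⟨D, hDc, hDT, hDd⟩ : ∃ D : Set X, D.Countable ∧ D ⊆ T ∧ T ⊆ closure D := by
    obtain ⟨D, hDT, hDc, hDd⟩ :=
      (TopologicalSpace.IsSeparable.of_separableSpace T).exists_countable_dense_subset
    exact ⟨D, hDc, hDT, hDd⟩
  -- `A n` collects the points where the slope bound holds up to distance 1/(n+1). Testing only
  -- against the countable dense set `D` keeps it measurable, and continuity of both sides extends
  -- the bound to all of `T`. These sets exhaust `T`.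
  set A : ℕ → Set X := fun n => T ∩ ⋂ b ∈ D,
    ({a | edist a b < ((n + 1 : ℝ≥0)⁻¹ : ℝ≥0)}ᶜ ∪
      {a | edist (φ a) (φ b) ≤ K a * edist a b}) with hA
  have hAm : ∀ n, MeasurableSet (A n) := fun n => by
    refine hT.inter (MeasurableSet.biInter hDc fun b _ => ?_)
    exact (measurableSet_lt (by fun_prop) (by fun_prop)).compl.union
      (measurableSet_le (by fun_prop) (by fun_prop))
  have hAloc : ∀ n, ∀ a ∈ A n, ∀ b ∈ T, edist a b < ((n + 1 : ℝ≥0)⁻¹ : ℝ≥0) →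
      edist (φ a) (φ b) ≤ K a * edist a b := by
    intro n a ha b hb hab
    have hcl : IsClosed {b | edist (φ a) (φ b) ≤ K a * edist a b} := by
      refine isClosed_le ?_ ?_
      · exact continuous_const.edist hφ.continuous
      · exact (ENNReal.continuous_const_mul (hKtop a)).comp (by fun_prop)
    have hop : IsOpen {b | edist a b < ((n + 1 : ℝ≥0)⁻¹ : ℝ≥0)} :=
      isOpen_lt (by fun_prop) (by fun_prop)
    have hbcl : b ∈ closure (D ∩ {b | edist a b < ((n + 1 : ℝ≥0)⁻¹ : ℝ≥0)}) := by
      rw [Set.inter_comm]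
      exact hop.inter_closure ⟨hab, hDd hb⟩
    refine hcl.closure_subset_iff.2 ?_ hbcl
    rintro c ⟨hcD, hc⟩
    have := Set.mem_iInter₂.1 ha.2 c hcD
    rcases this with h | h
    · exact absurd hc h
    · exact h
  have hAmono : Antitone fun n => (A n)ᶜ := by
    intro m n hmn
    refine Set.compl_subset_compl.2 fun a ha => ⟨ha.1, Set.mem_iInter₂.2 fun b hb => ?_⟩
    rcases Set.mem_iInter₂.1 ha.2 b hb with h | h
    · refine Or.inl fun h' => h (lt_of_lt_of_le (Set.mem_ofPred_eq ▸ h') ?_)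
      gcongr
    · exact Or.inr h
  have hAlim : Tendsto (fun n => μ (A n)ᶜ) atTop (𝓝 0) := by
    have h := tendsto_measure_iInter_atTop (μ := μ)
      (fun n => (hAm n).compl.nullMeasurableSet) hAmono ⟨0, measure_ne_top _ _⟩
    have h0 : μ (⋂ n, (A n)ᶜ) = 0 := by
      refine measure_mono_null (fun a ha => ?_) hμT
      intro haT
      obtain ⟨r, hr, hball⟩ := Metric.mem_nhdsWithin_iff.1 (hloc a haT)
      obtain ⟨n, hn⟩ := exists_nat_one_div_lt hr
      refine Set.mem_iInter.1 ha n ⟨haT, Set.mem_iInter₂.2 fun b hb => ?_⟩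
      by_cases hab : edist a b < ((n + 1 : ℝ≥0)⁻¹ : ℝ≥0)
      · refine Or.inr (hball ⟨?_, hDT hb⟩)
        rw [Metric.mem_ball, dist_comm]
        refine lt_trans ?_ hn
        rw [edist_nndist, ENNReal.coe_lt_coe, ← NNReal.coe_lt_coe] at hab
        simpa using hab
      · exact Or.inl hab
    rwa [h0] at h
  set J := ∫⁻ a, K a ^ q ∂μ with hJ
  -- The strict inequality W < W' supplies, for small ε, a plan of cost below (εW')^p. Three limits
  -- follow in this order: ε → 0 with n fixed, n → ∞, W' → W.
  have main : ∀ W', W < W' → W' ≠ ⊤ → edist (φ x) (φ y) ≤ J ^ (1 / q) * W' := by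
    intro W' hWW' hW'
    have key : ∀ n, edist (φ x) (φ y) ≤ (J + (L : ℝ≥0∞) ^ q * μ (A n)ᶜ) ^ (1 / q) * W' := by
      intro n
      set δ : ℝ≥0 := (n + 1 : ℝ≥0)⁻¹ with hδ
      have hδ0 : δ ≠ 0 := by positivity
      have hδi : ((δ : ℝ≥0∞) ^ p)⁻¹ ≠ ⊤ := by
        simp [ENNReal.inv_eq_top, ENNReal.rpow_eq_zero_iff, hδ0]
      have hev : ∀ᶠ ε : ℝ≥0 in 𝓝[>] 0, edist (φ x) (φ y) ≤
          (J + ε * K x ^ q + (L : ℝ≥0∞) ^ q * (μ (A n)ᶜ + ε)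
            + (L : ℝ≥0∞) ^ q * (((δ : ℝ≥0∞) ^ p)⁻¹ * (ε * W') ^ p)) ^ (1 / q) * W' := by
        filter_upwards [(tendsto_order.1 hW).2 W' hWW', self_mem_nhdsWithin] with ε hε hpos
        have hpos : (0 : ℝ≥0) < ε := hpos
        have hε0 : (ε : ℝ≥0∞) ≠ 0 := by simpa using hpos.ne'
        have hlt : wasserstein p (μ + ε • Measure.dirac x) (μ + ε • Measure.dirac y)
            < ε * W' := by
          rw [mul_comm, ← div_eq_mul_inv, ENNReal.div_lt_iff (Or.inl hε0) (Or.inl (by simp))]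
            at hε
          rwa [mul_comm]
        obtain ⟨π, hπ, hc⟩ := exists_plan_of_wasserstein_lt hp hlt
        have h := mul_edist_le_of_plan hT hμT hy hpq hφ hint hK (hAm n) hδ0 (hAloc n) ε hπ
        have hc' : ∫⁻ z, edist z.1 z.2 ^ p ∂π ≤ (ε * W') ^ p := by
          have := ENNReal.rpow_le_rpow hc.le hp.le
          rwa [← ENNReal.rpow_mul, one_div_mul_cancel hp.ne', ENNReal.rpow_one] at this
        have h' : ε * edist (φ x) (φ y) ≤ (J + ε * K x ^ q + (L : ℝ≥0∞) ^ q * (μ (A n)ᶜ + ε)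
            + (L : ℝ≥0∞) ^ q * (((δ : ℝ≥0∞) ^ p)⁻¹ * (ε * W') ^ p)) ^ (1 / q) * (ε * W') := by
          refine h.trans ?_
          gcongr
        rw [mul_left_comm] at h'
        exact (ENNReal.mul_le_mul_iff_right hε0 (by simp)).1 h'
      refine ge_of_tendsto ?_ hev
      have t0 : Tendsto (fun ε : ℝ≥0 => (ε : ℝ≥0∞)) (𝓝[>] 0) (𝓝 0) := by
        have : Tendsto (fun ε : ℝ≥0 => (ε : ℝ≥0∞)) (𝓝 0) (𝓝 ((0 : ℝ≥0) : ℝ≥0∞)) :=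
          ENNReal.tendsto_coe.2 tendsto_id
        exact this.mono_left nhdsWithin_le_nhds
      have hLq : (L : ℝ≥0∞) ^ q ≠ ⊤ := ENNReal.rpow_ne_top_of_nonneg hq.le (by simp)
      have t1 : Tendsto (fun ε : ℝ≥0 => (ε : ℝ≥0∞) * K x ^ q) (𝓝[>] 0) (𝓝 (0 * K x ^ q)) :=
        ENNReal.Tendsto.mul_const t0
          (Or.inr (ENNReal.rpow_ne_top_of_nonneg hq.le (hKtop x)))
      have t2 : Tendsto (fun ε : ℝ≥0 => (L : ℝ≥0∞) ^ q * (μ (A n)ᶜ + ε)) (𝓝[>] 0)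
          (𝓝 ((L : ℝ≥0∞) ^ q * (μ (A n)ᶜ + 0))) :=
        ENNReal.Tendsto.const_mul (tendsto_const_nhds.add t0) (Or.inr hLq)
      have t3 : Tendsto (fun ε : ℝ≥0 => ((ε : ℝ≥0∞) * W') ^ p) (𝓝[>] 0) (𝓝 ((0 * W') ^ p)) :=
        ((ENNReal.continuous_rpow_const (y := p)).tendsto _).comp
          (ENNReal.Tendsto.mul_const t0 (Or.inr hW'))
      have t4 : Tendsto (fun ε : ℝ≥0 =>
          (L : ℝ≥0∞) ^ q * (((δ : ℝ≥0∞) ^ p)⁻¹ * ((ε : ℝ≥0∞) * W') ^ p)) (𝓝[>] 0)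
          (𝓝 ((L : ℝ≥0∞) ^ q * (((δ : ℝ≥0∞) ^ p)⁻¹ * (0 * W') ^ p))) :=
        ENNReal.Tendsto.const_mul (ENNReal.Tendsto.const_mul t3 (Or.inr hδi)) (Or.inr hLq)
      have t5 := ((ENNReal.continuous_rpow_const (y := 1 / q)).tendsto _).comp
        (((tendsto_const_nhds (x := J)).add t1).add t2 |>.add t4)
      have t6 := ENNReal.Tendsto.mul_const t5 (Or.inr hW')
      simpa [ENNReal.zero_rpow_of_pos hp] using t6
    have hLq : (L : ℝ≥0∞) ^ q ≠ ⊤ := ENNReal.rpow_ne_top_of_nonneg hq.le (by simp)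
    have t1 := (tendsto_const_nhds (x := J)).add
      (ENNReal.Tendsto.const_mul hAlim (Or.inr hLq))
    have t2 := ENNReal.Tendsto.mul_const
      (((ENNReal.continuous_rpow_const (y := 1 / q)).tendsto _).comp t1) (Or.inr hW')
    refine ge_of_tendsto (x := (atTop : Filter ℕ)) (a := J ^ (1 / q) * W') ?_
      (Eventually.of_forall key)
    simpa using t2
  have hJtop : J ^ (1 / q) ≠ ⊤ := ENNReal.rpow_ne_top_of_nonneg (by positivity) hKint
  have hlim : Tendsto (fun W' => J ^ (1 / q) * W') (𝓝[>] W) (𝓝 (J ^ (1 / q) * W)) :=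
    ((ENNReal.continuous_const_mul hJtop).tendsto W).mono_left nhdsWithin_le_nhds
  have : (𝓝[>] W).NeBot := nhdsGT_neBot_of_exists_gt ⟨⊤, hWtop.lt_top⟩
  refine ge_of_tendsto hlim ?_
  filter_upwards [self_mem_nhdsWithin, Ioo_mem_nhdsGT hWtop.lt_top] with W' h1 h2
  exact main W' h1 h2.2.ne

end Duality

/-! ### Systems of potentials and the resulting lower bound. -/

section SlopeSystem

variable {X : Type*} [MetricSpace X]

/-- Finitely many potentials on `T`, each increasing from `x` to `y` by the length `len i`, such
that locally only one of them varies, with slope at most one, and only on its `piece i`. -/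
structure SlopeSystem (T : Set X) (x y : X) (ι : Type*) where
  pot : ι → X → ℝ
  piece : ι → Set X
  len : ι → ℝ≥0
  isClosed_piece : ∀ i, IsClosed (piece i)
  piece_subset : ∀ i, piece i ⊆ T
  lipschitz : ∀ i, ∃ L, LipschitzOnWith L (pot i) T
  pot_source : ∀ i, pot i x = 0
  pot_target : ∀ i, pot i y = len i
  slope : ∀ a ∈ T, ∀ᶠ b in 𝓝[T] a, (∀ i, pot i b = pot i a) ∨
    ∃ i, a ∈ piece i ∧ dist (pot i b) (pot i a) ≤ dist b a ∧ ∀ j ≠ i, pot j b = pot j a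

namespace SlopeSystem

variable {T : Set X} {x y : X} {ι : Type*}

/-- Cut the `i₀`-th potential at the level `l`. -/
def split [DecidableEq ι] (S : SlopeSystem T x y ι) (i₀ : ι) (l : ℝ≥0) (hl : l ≤ S.len i₀) :
    SlopeSystem T x y (Option ι) where
  pot o z := o.elim (max (S.pot i₀ z) l - l)
    fun i => if i = i₀ then min (S.pot i₀ z) l else S.pot i z
  piece o := o.elim (S.piece i₀ ∩ S.pot i₀ ⁻¹' Set.Ici (l : ℝ))
    fun i => if i = i₀ then S.piece i₀ ∩ S.pot i₀ ⁻¹' Set.Iic (l : ℝ) else S.piece i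
  len o := o.elim (S.len i₀ - l) fun i => if i = i₀ then l else S.len i
  isClosed_piece o := by
    obtain ⟨L, hL⟩ := S.lipschitz i₀
    have hc : ContinuousOn (S.pot i₀) (S.piece i₀) := hL.continuousOn.mono (S.piece_subset i₀)
    rcases o with _ | i
    · exact hc.preimage_isClosed_of_isClosed (S.isClosed_piece i₀) isClosed_Ici
    · dsimp only [Option.elim_some]
      split_ifs
      · exact hc.preimage_isClosed_of_isClosed (S.isClosed_piece i₀) isClosed_Iic
      · exact S.isClosed_piece i
  piece_subset o := by
    rcases o with _ | i
    · exact Set.inter_subset_left.trans (S.piece_subset i₀)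
    · dsimp only [Option.elim_some]
      split_ifs
      · exact Set.inter_subset_left.trans (S.piece_subset i₀)
      · exact S.piece_subset i
  lipschitz o := by
    obtain ⟨L, hL⟩ := S.lipschitz i₀
    rcases o with _ | i
    · refine ⟨L, LipschitzOnWith.of_dist_le_mul fun a ha b hb => ?_⟩
      have := hL.dist_le_mul a ha b hb
      refine le_trans ?_ this
      simp only [Option.elim_none, Real.dist_eq]
      rw [sub_sub_sub_cancel_right]
      exact abs_max_sub_max_le_abs _ _ _
    · dsimp only [Option.elim_some]
      split_ifs
      · refine ⟨L, LipschitzOnWith.of_dist_le_mul fun a ha b hb => ?_⟩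
        refine le_trans ?_ (hL.dist_le_mul a ha b hb)
        simp only [Real.dist_eq]
        have := abs_min_sub_min_le_max (S.pot i₀ a) l (S.pot i₀ b) l
        simpa using this
      · exact S.lipschitz i
  pot_source o := by
    rcases o with _ | i
    · simp [S.pot_source]
    · dsimp only [Option.elim_some]
      split_ifs
      · simp [S.pot_source]
      · exact S.pot_source i
  pot_target o := by
    rcases o with _ | i
    · simp [S.pot_target, NNReal.coe_sub hl, hl]
    · dsimp only [Option.elim_some]
      split_ifs
      · simp [S.pot_target, hl]
      · exact S.pot_target i
  slope a ha := by
    obtain ⟨L, hL⟩ := S.lipschitz i₀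
    have hc : Tendsto (S.pot i₀) (𝓝[T] a) (𝓝 (S.pot i₀ a)) := hL.continuousOn a ha
    -- Points near `a` lie on the same closed side of the level `l` as `a`, so only one half of the
    -- cut potential varies. If `a` is exactly on the level, `b` decides which half; both closed
    -- pieces contain `a`.
    have h1 : ∀ᶠ b in 𝓝[T] a, S.pot i₀ a < l → S.pot i₀ b < l := by
      by_cases h : S.pot i₀ a < l
      · filter_upwards [(tendsto_order.1 hc).2 _ h] with b hb _ using hb
      · exact Eventually.of_forall fun b h' => absurd h' h
    have h2 : ∀ᶠ b in 𝓝[T] a, l < S.pot i₀ a → l < S.pot i₀ b := by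
      by_cases h : l < S.pot i₀ a
      · filter_upwards [(tendsto_order.1 hc).1 _ h] with b hb _ using hb
      · exact Eventually.of_forall fun b h' => absurd h' h
    filter_upwards [S.slope a ha, h1, h2] with b hb h1 h2
    rcases hb with hb | ⟨i, hai, hd, hj⟩
    · left
      rintro (_ | i) <;> simp [hb]
    · right
      by_cases hi : i = i₀
      · subst hi
        by_cases hlo : S.pot i a ≤ l ∧ S.pot i b ≤ l
        · refine ⟨some i, ?_, ?_, ?_⟩
          · simp [hai, hlo.1]
          · simpa [hlo.1, hlo.2] using hd
          · rintro (_ | j) hne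
            · simp [hlo.1, hlo.2]
            · have : j ≠ i := fun h => hne (by rw [h])
              simp [this, hj j this]
        · have hhi : (l : ℝ) ≤ S.pot i a ∧ (l : ℝ) ≤ S.pot i b := by
            rcases lt_trichotomy (S.pot i a) l with h | h | h
            · exact absurd ⟨h.le, (h1 h).le⟩ hlo
            · refine ⟨h.ge, ?_⟩
              by_contra hcon
              exact hlo ⟨h.le, (not_le.1 hcon).le⟩
            · exact ⟨h.le, (h2 h).le⟩
          refine ⟨none, ?_, ?_, ?_⟩
          · simp [hai, hhi.1]
          · simpa [hhi.1, hhi.2] using hd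
          · rintro (_ | j) hne
            · exact absurd rfl hne
            · by_cases hji : j = i
              · subst hji
                simp [hhi.1, hhi.2]
              · simp [hji, hj j hji]
      · refine ⟨some i, ?_, ?_, ?_⟩
        · simp [hi, hai]
        · simpa [hi] using hd
        · have h0 := hj i₀ (Ne.symm hi)
          rintro (_ | j) hne
          · simp [h0]
          · have : j ≠ i := fun h => hne (by rw [h])
            by_cases hji : j = i₀
            · simp [hji, h0]
            · simp [hji, hj j this]

variable [MeasurableSpace X] [BorelSpace X] [SecondCountableTopology X] [Fintype ι]

/-- The duality bound for ∑ c_i pot_i, extended from `T` to the whole space as a Lipschitz function.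
-/
lemma sum_mul_len_le (S : SlopeSystem T x y ι) (hT : IsCompact T) {μ : Measure X}
    [IsFiniteMeasure μ] (hμT : μ Tᶜ = 0) (hy : y ∈ T) (hx : x ∈ T) {p q : ℝ}
    (hpq : p.HolderConjugate q) (c : ι → ℝ≥0) {W : ℝ≥0∞} (hWtop : W ≠ ⊤)
    (hW : IsCondWasserstein p (Measure.dirac x) (Measure.dirac y) μ W) :
    ∑ i, (c i : ℝ≥0∞) * S.len i ≤
      (∑ i, (c i : ℝ≥0∞) ^ q * μ (S.piece i)) ^ (1 / q) * W := by
  have hq := hpq.symm.pos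
  choose L hL using S.lipschitz
  set φ₀ : X → ℝ := fun z => ∑ i, c i * S.pot i z with hφ₀
  have hlip : LipschitzOnWith (∑ i, c i * L i) φ₀ T := by
    refine LipschitzOnWith.of_dist_le_mul fun a ha b hb => ?_
    calc dist (φ₀ a) (φ₀ b) ≤ ∑ i, dist (c i * S.pot i a) (c i * S.pot i b) :=
          dist_sum_sum_le _ _ _
      _ ≤ ∑ i, (c i * L i) * dist a b := by
          refine Finset.sum_le_sum fun i _ => ?_
          rw [Real.dist_eq, ← mul_sub, abs_mul, NNReal.abs_eq, mul_assoc]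
          gcongr
          exact (hL i).dist_le_mul a ha b hb
      _ = _ := by push_cast; rw [Finset.sum_mul]
  obtain ⟨φ, hφ, heq⟩ := hlip.extend_real
  have hTm := hT.measurableSet
  have hint : Integrable φ μ := by
    have h := hφ.continuous.continuousOn.integrableOn_compact (μ := μ) hT
    rwa [IntegrableOn, Measure.restrict_eq_self_of_ae_mem] at h
    exact hμT
  -- This is the q-th power of the slope bound. Where pieces overlap, the sum dominates every c_i^q,
  -- and its integral counts an atom there once for each piece, just as the numbers `μ (S.piece i)`
  -- do. No hypothesis on atoms is needed.
  set K₀ : X → ℝ≥0∞ := fun a => ∑ i, (S.piece i).indicator (fun _ => (c i : ℝ≥0∞) ^ q) a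
    with hK₀
  have hK₀m : Measurable K₀ := Finset.measurable_fun_sum _ fun i _ =>
    measurable_const.indicator (S.isClosed_piece i).measurableSet
  have hK₀top : ∀ a, K₀ a ≠ ⊤ := fun a => by
    refine ENNReal.sum_ne_top.2 fun i _ => ?_
    by_cases h : a ∈ S.piece i <;> simp [h, hq.le]
  have hK₀int : ∫⁻ a, K₀ a ∂μ = ∑ i, (c i : ℝ≥0∞) ^ q * μ (S.piece i) := by
    rw [lintegral_finsetSum _ fun i _ =>
      measurable_const.indicator (S.isClosed_piece i).measurableSet]
    refine Finset.sum_congr rfl fun i _ => ?_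
    rw [lintegral_indicator (S.isClosed_piece i).measurableSet, setLIntegral_const]
  have hpow : ∀ a, (K₀ a ^ (1 / q)) ^ q = K₀ a := fun a => by
    rw [← ENNReal.rpow_mul, one_div_mul_cancel hq.ne', ENNReal.rpow_one]
  have main := edist_le_lintegral_slope_mul hTm hμT (x := x) hy hpq hφ hint
    (K := fun a => K₀ a ^ (1 / q)) (hK₀m.pow_const _)
    (fun a => ENNReal.rpow_ne_top_of_nonneg (by positivity) (hK₀top a)) ?_ ?_ hWtop hW
  · simp only [hpow, hK₀int] at main
    refine le_trans (le_of_eq ?_) main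
    rw [← heq hx, ← heq hy, edist_comm, edist_eq_enorm_sub]
    simp only [hφ₀, S.pot_source, S.pot_target, mul_zero, Finset.sum_const_zero, sub_zero]
    have : ∑ i, (c i : ℝ) * (S.len i : ℝ) = ((∑ i, c i * S.len i : ℝ≥0) : ℝ) := by push_cast; rfl
    rw [this, Real.enorm_eq_ofReal (by positivity), ENNReal.ofReal_coe_nnreal]
    push_cast
    rfl
  · simp only [hpow, hK₀int]
    exact ENNReal.sum_ne_top.2 fun i _ => ENNReal.mul_ne_top
      (ENNReal.rpow_ne_top_of_nonneg hq.le (by simp)) (measure_ne_top _ _)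
  · intro a ha
    filter_upwards [S.slope a ha, self_mem_nhdsWithin] with b hb hbT
    rw [← heq ha, ← heq hbT]
    rcases hb with hb | ⟨i, hai, hd, hj⟩
    · simp [hφ₀, hb]
    · have h1 : dist (φ₀ a) (φ₀ b) ≤ c i * dist a b := by
        have : φ₀ a - φ₀ b = c i * (S.pot i a - S.pot i b) := by
          simp only [hφ₀]
          rw [← Finset.sum_sub_distrib, Finset.sum_eq_single i]
          · ring
          · intro j _ hji
            rw [hj j hji, sub_self]
          · simp
        rw [Real.dist_eq, this, abs_mul, NNReal.abs_eq]
        gcongr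
        rwa [dist_comm a b, ← Real.dist_eq, dist_comm]
      have h2 : (c i : ℝ≥0∞) ≤ K₀ a ^ (1 / q) := by
        rw [one_div, ENNReal.le_rpow_inv_iff hq]
        refine le_trans ?_ (Finset.single_le_sum (f := fun i =>
          (S.piece i).indicator (fun _ => (c i : ℝ≥0∞) ^ q) a) (fun _ _ => zero_le)
          (Finset.mem_univ i))
        simp [hai]
      refine le_trans ?_ (mul_le_mul_left h2 _)
      rw [edist_nndist, edist_nndist, ← ENNReal.coe_mul, ENNReal.coe_le_coe]
      exact_mod_cast h1

/-- The lower bound for the conditional Wasserstein distance. -/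
theorem sum_len_mul_rpow_le (S : SlopeSystem T x y ι) (hT : IsCompact T) {μ : Measure X}
    [IsFiniteMeasure μ] (hμT : μ Tᶜ = 0) (hy : y ∈ T) (hx : x ∈ T) {p : ℝ} (hp : 1 < p)
    (hlen : ∀ i, S.len i ≠ 0) (s : ι → ℝ≥0) (hs : ∀ i, μ (S.piece i) = S.len i * s i)
    {W : ℝ≥0∞} (hW : IsCondWasserstein p (Measure.dirac x) (Measure.dirac y) μ W) :
    ∑ i, (S.len i : ℝ≥0∞) * (s i : ℝ≥0∞) ^ (1 - p) ≤ W ^ p := by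
  classical
  have hp0 : 0 < p := by linarith
  have hpq := Real.HolderConjugate.conjExponent hp
  set q := p.conjExponent with hqdef
  have hq := hpq.symm.pos
  by_cases hWtop : W = ⊤
  · simp [hWtop, hp0]
  have key := fun c => S.sum_mul_len_le hT hμT hy hx hpq c hWtop hW
  -- If a piece had no mass, its potential alone would give len_i ≤ 0 · W, impossible for finite W.
  have hs0 : ∀ i, s i ≠ 0 := by
    intro i hi
    have h := key (Pi.single i 1)
    have e1 : ∑ j, ((Pi.single i 1 : ι → ℝ≥0) j : ℝ≥0∞) * S.len j = S.len i := by
      rw [Finset.sum_eq_single i]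
      · simp
      · intro j _ hj; simp [hj]
      · simp
    have e2 : ∑ j, ((Pi.single i 1 : ι → ℝ≥0) j : ℝ≥0∞) ^ q * μ (S.piece j) = 0 := by
      refine Finset.sum_eq_zero fun j _ => ?_
      by_cases hj : j = i
      · subst hj; simp [hs, hi]
      · simp [hj, hq]
    rw [e1, e2, ENNReal.zero_rpow_of_pos (by positivity), zero_mul] at h
    exact hlen i (by simpa using h)
  -- The equality case of Hölder: since (1-p)q + 1 = 1-p, both sums become the same number R, and R
  -- ≤ R^{1/q} W.
  have h := key fun i => s i ^ (1 - p)
  have hcoe : ∀ i, ((s i ^ (1 - p) : ℝ≥0) : ℝ≥0∞) = (s i : ℝ≥0∞) ^ (1 - p) := fun i =>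
    ENNReal.coe_rpow_of_ne_zero (hs0 i) _
  have hexp : (1 - p) * q + 1 = 1 - p := by
    have := hpq.sub_one_mul_conj
    linarith
  have e1 : ∀ i, (((s i ^ (1 - p) : ℝ≥0) : ℝ≥0∞)) ^ q * μ (S.piece i) =
      S.len i * (s i : ℝ≥0∞) ^ (1 - p) := fun i => by
    rw [hcoe, hs, ← ENNReal.rpow_mul, mul_left_comm]
    congr 1
    conv_lhs => rw [← ENNReal.rpow_one (s i : ℝ≥0∞), ← ENNReal.rpow_mul, one_mul,
      ← ENNReal.rpow_add _ _ (by simpa using hs0 i) (by simp), hexp]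
  simp only [e1] at h
  have e2 : ∑ i, ((s i ^ (1 - p) : ℝ≥0) : ℝ≥0∞) * S.len i =
      ∑ i, (S.len i : ℝ≥0∞) * (s i : ℝ≥0∞) ^ (1 - p) :=
    Finset.sum_congr rfl fun i _ => by rw [hcoe, mul_comm]
  rw [e2] at h
  set R := ∑ i, (S.len i : ℝ≥0∞) * (s i : ℝ≥0∞) ^ (1 - p) with hR
  have hRtop : R ≠ ⊤ := ENNReal.sum_ne_top.2 fun i _ => by
    rw [← hcoe]; exact ENNReal.mul_ne_top (by simp) (by simp)
  by_cases hR0 : R = 0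
  · simp [hR0]
  have hR1 : R ^ (1 / p) ≤ W := by
    have h3 : R = R ^ (1 / q) * R ^ (1 / p) := by
      rw [← ENNReal.rpow_add _ _ hR0 hRtop]
      have : 1 / q + 1 / p = 1 := by
        have := hpq.symm.inv_add_inv_eq_one
        simpa [one_div] using this
      rw [this, ENNReal.rpow_one]
    rw [h3] at h
    refine (ENNReal.mul_le_mul_iff_right ?_ ?_).1
      (h.trans (le_of_eq (by rw [← h3])))
    · simp [ENNReal.rpow_eq_zero_iff, hR0, hRtop]
    · exact ENNReal.rpow_ne_top_of_nonneg (by positivity) hRtop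
  have := ENNReal.rpow_le_rpow hR1 hp0.le
  rwa [← ENNReal.rpow_mul, one_div_mul_cancel hp0.ne', ENNReal.rpow_one] at this

end SlopeSystem

end SlopeSystem

/-! ### Geometry of the tree and its edge potentials. -/

section Network

/-- An edge of a trail splits it into two walks that avoid this edge. -/
lemma exists_reachable_deleteEdges_of_mem_edges {V : Type*} {G : SimpleGraph V} {x y : V}
    (q : G.Walk x y) (hq : q.IsTrail) {e : Sym2 V} (he : e ∈ q.edges) :
    ∃ u v, e = s(u, v) ∧ G.Adj u v ∧ (G.deleteEdges {s(u, v)}).Reachable x u ∧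
      (G.deleteEdges {s(u, v)}).Reachable v y := by
  induction q with
  | nil => simp at he
  | @cons x w y h p ih =>
    rw [SimpleGraph.Walk.isTrail_cons] at hq
    rw [SimpleGraph.Walk.edges_cons, List.mem_cons] at he
    rcases he with rfl | he
    · exact ⟨x, w, rfl, h, SimpleGraph.Reachable.refl _, ⟨p.toDeleteEdge _ hq.2⟩⟩
    · obtain ⟨u, v, rfl, huv, h1, h2⟩ := ih hq.1 he
      refine ⟨u, v, rfl, huv, SimpleGraph.Reachable.trans (SimpleGraph.Adj.reachable ?_) h1, h2⟩
      rw [SimpleGraph.deleteEdges_adj]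
      exact ⟨h, fun hc => hq.2 (by rw [Set.mem_singleton_iff] at hc; rwa [hc])⟩

/-- Two segments that only meet in a common endpoint leave it at a positive angle. -/
lemma exists_dist_add_dist_le_mul_dist {E : Type*} [NormedAddCommGroup E] [NormedSpace ℝ E]
    {a b c : E} (hb : b ≠ a) (hc : c ≠ a)
    (hinter : ∀ z ∈ segment ℝ a b, z ∈ segment ℝ a c → z = a) :
    ∃ C : ℝ≥0, ∀ z ∈ segment ℝ a b, ∀ z' ∈ segment ℝ a c,
      dist z a + dist a z' ≤ C * dist z z' := by
  -- The vector s(b-a) - t(c-a) is s + t times a point of this segment. The segment avoids 0 because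
  -- the two edges share only `a`, so its least norm gives the constant.
  have hcpt : IsCompact (segment ℝ (b - a) (-(c - a))) := by
    rw [segment_eq_image_lineMap]
    exact isCompact_Icc.image (by fun_prop)
  obtain ⟨w, hw, hmin⟩ := hcpt.exists_isMinOn ⟨_, left_mem_segment ℝ _ _⟩
    continuous_norm.continuousOn
  have hw0 : w ≠ 0 := by
    rintro rfl
    obtain ⟨s, t, hs, ht, hst, h⟩ := hw
    have h' : s • (b - a) = t • (c - a) := by
      rw [smul_neg, ← sub_eq_add_neg] at h
      exact sub_eq_zero.1 h
    have hz : a + s • (b - a) = a := by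
      refine hinter _ ?_ ?_
      · rw [segment_eq_image']
        exact ⟨s, ⟨hs, by linarith⟩, rfl⟩
      · rw [h', segment_eq_image']
        exact ⟨t, ⟨ht, by linarith⟩, rfl⟩
    have hs0 : s • (b - a) = 0 := by simpa using hz
    have hs1 : s = 0 := (smul_eq_zero.1 hs0).resolve_right (sub_ne_zero.2 hb)
    rw [hs0] at h'
    have ht1 : t = 0 := (smul_eq_zero.1 h'.symm).resolve_right (sub_ne_zero.2 hc)
    linarith
  have hm : 0 < ‖w‖ := norm_pos_iff.2 hw0
  refine ⟨(‖b - a‖₊ + ‖c - a‖₊) / ‖w‖₊, fun z hz z' hz' => ?_⟩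
  rw [segment_eq_image'] at hz hz'
  obtain ⟨s, ⟨hs, -⟩, rfl⟩ := hz
  obtain ⟨t, ⟨ht, -⟩, rfl⟩ := hz'
  have e1 : dist (a + s • (b - a)) a = s * ‖b - a‖ := by
    rw [dist_eq_norm, add_sub_cancel_left, norm_smul, Real.norm_of_nonneg hs]
  have e2 : dist a (a + t • (c - a)) = t * ‖c - a‖ := by
    rw [dist_comm, dist_eq_norm, add_sub_cancel_left, norm_smul, Real.norm_of_nonneg ht]
  have e3 : (s + t) * ‖w‖ ≤ dist (a + s • (b - a)) (a + t • (c - a)) := by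
    rw [dist_add_left, dist_eq_norm]
    rcases (add_nonneg hs ht).eq_or_lt with h0 | hpos
    · rw [← h0, zero_mul]; exact norm_nonneg _
    · have hmem : (s / (s + t)) • (b - a) + (t / (s + t)) • (-(c - a)) ∈
          segment ℝ (b - a) (-(c - a)) :=
        ⟨_, _, by positivity, by positivity, by field_simp, rfl⟩
      have := hmin hmem
      have e4 : s • (b - a) - t • (c - a) =
          (s + t) • ((s / (s + t)) • (b - a) + (t / (s + t)) • (-(c - a))) := by
        rw [smul_add, smul_smul, smul_smul, mul_div_cancel₀ _ hpos.ne',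
          mul_div_cancel₀ _ hpos.ne', smul_neg, sub_eq_add_neg]
      rw [e4, norm_smul, Real.norm_of_nonneg hpos.le]
      exact mul_le_mul_of_nonneg_left this hpos.le
  rw [e1, e2]
  push_cast
  rw [div_mul_eq_mul_div, le_div_iff₀ hm]
  calc (s * ‖b - a‖ + t * ‖c - a‖) * ‖w‖
      ≤ (‖b - a‖ + ‖c - a‖) * ((s + t) * ‖w‖) := by
        rw [← mul_assoc]
        gcongr
        nlinarith [norm_nonneg (b - a), norm_nonneg (c - a)]
    _ ≤ _ := by gcongr

variable {d : ℕ}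

lemma edgeSegment_mk (u v : EuclideanSpace ℝ (Fin d)) : edgeSegment s(u, v) = segment ℝ u v := rfl

lemma edgeLength_mk (u v : EuclideanSpace ℝ (Fin d)) : edgeLength s(u, v) = nndist u v := rfl

lemma isCompact_edgeSegment (e : Sym2 (EuclideanSpace ℝ (Fin d))) :
    IsCompact (edgeSegment e) := by
  induction e with | _ u v =>
  rw [edgeSegment_mk, segment_eq_image_lineMap]
  exact isCompact_Icc.image (by fun_prop)

lemma mem_edgeSegment {e : Sym2 (EuclideanSpace ℝ (Fin d))} {z} (hz : z ∈ e) :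
    z ∈ edgeSegment e := by
  induction e with | _ u v =>
  rcases Sym2.mem_iff.1 hz with rfl | rfl
  · exact left_mem_segment ℝ _ _
  · exact right_mem_segment ℝ _ _

namespace TreeNetwork

variable (T : TreeNetwork d)

lemma isCompact_carrier : IsCompact T.carrier :=
  T.finite_edges.isCompact_biUnion fun e _ => isCompact_edgeSegment e

lemma edgeSegment_subset_carrier {e} (he : e ∈ T.graph.edgeSet) :
    edgeSegment e ⊆ T.carrier :=
  Set.subset_biUnion_of_mem (u := fun e => edgeSegment e) he

lemma mem_carrier {z} : z ∈ T.carrier ↔ ∃ e ∈ T.graph.edgeSet, z ∈ edgeSegment e := by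
  simp [carrier]

/-- `w` lies on the side of `v` when the edge from `u` to `v` is removed. -/
def Beyond (u v w : EuclideanSpace ℝ (Fin d)) : Prop :=
  (T.graph.deleteEdges {s(u, v)}).Reachable v w

open Classical in
/-- The position along the edge from `u` to `v`, extended to the network so as to be constant on
all other edges. -/
def pos (u v z : EuclideanSpace ℝ (Fin d)) : ℝ :=
  if z ∈ segment ℝ u v then dist z u
  else if ∃ f ∈ T.graph.edgeSet, ∃ w ∈ f, z ∈ edgeSegment f ∧ T.Beyond u v w then dist u v else 0

variable {T} {u v : EuclideanSpace ℝ (Fin d)}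

lemma not_beyond_left (huv : T.graph.Adj u v) : ¬ T.Beyond u v u := fun h =>
  SimpleGraph.isBridge_iff.1
    (SimpleGraph.isAcyclic_iff_forall_adj_isBridge.1 T.acyclic huv) h.symm

lemma beyond_right : T.Beyond u v v := SimpleGraph.Reachable.refl _

lemma beyond_iff_of_mem {f} (hf : f ∈ T.graph.edgeSet) (hne : f ≠ s(u, v)) {w w'}
    (hw : w ∈ f) (hw' : w' ∈ f) : T.Beyond u v w ↔ T.Beyond u v w' := by
  by_cases h : w = w'
  · rw [h]
  have hfe : f = s(w, w') := ((Sym2.mem_and_mem_iff h).1 ⟨hw, hw'⟩)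
  have hadj : (T.graph.deleteEdges {s(u, v)}).Adj w w' := by
    rw [SimpleGraph.deleteEdges_adj]
    subst hfe
    exact ⟨hf, hne⟩
  exact ⟨fun h => h.trans hadj.reachable, fun h => h.trans hadj.symm.reachable⟩

open Classical in
-- An edge other than uv survives its deletion and so lies wholly on one side. A point shared by
-- several edges is an endpoint of each, hence the prescriptions agree there, also at u and v
-- themselves.
lemma pos_of_mem_other (huv : T.graph.Adj u v) {f} (hf : f ∈ T.graph.edgeSet)
    (hne : f ≠ s(u, v)) {w z} (hw : w ∈ f) (hz : z ∈ edgeSegment f) :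
    T.pos u v z = if T.Beyond u v w then dist u v else 0 := by
  rw [pos]
  by_cases hze : z ∈ segment ℝ u v
  · rw [if_pos hze]
    obtain ⟨hzf, hze'⟩ := T.embedded f hf s(u, v) huv hne z ⟨hz, hze⟩
    have h := beyond_iff_of_mem hf hne hw hzf
    rcases Sym2.mem_iff.1 hze' with rfl | rfl
    · rw [if_neg (h.not.2 (not_beyond_left huv)), dist_self]
    · rw [if_pos (h.2 beyond_right), dist_comm]
  · rw [if_neg hze]
    refine if_congr ⟨?_, fun h => ⟨f, hf, w, hw, hz, h⟩⟩ rfl rfl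
    rintro ⟨f', hf', w', hw', hz', h⟩
    have hne' : f' ≠ s(u, v) := by
      rintro rfl
      exact hze hz'
    by_cases hff : f' = f
    · subst hff
      exact (beyond_iff_of_mem hf hne hw' hw).1 h
    · obtain ⟨h1, h2⟩ := T.embedded f' hf' f hf hff z ⟨hz', hz⟩
      exact (beyond_iff_of_mem hf hne h2 hw).1 ((beyond_iff_of_mem hf' hne' hw' h1).1 h)

lemma pos_of_mem {z} (hz : z ∈ segment ℝ u v) : T.pos u v z = dist z u := by
  rw [pos, if_pos hz]

open Classical in
lemma pos_vertex (huv : T.graph.Adj u v) {f} (hf : f ∈ T.graph.edgeSet) {w} (hw : w ∈ f) :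
    T.pos u v w = if T.Beyond u v w then dist u v else 0 := by
  by_cases hne : f = s(u, v)
  · subst hne
    rw [pos_of_mem (mem_edgeSegment hw)]
    rcases Sym2.mem_iff.1 hw with rfl | rfl
    · rw [if_neg (not_beyond_left huv), dist_self]
    · rw [if_pos beyond_right, dist_comm]
  · exact pos_of_mem_other huv hf hne hw (mem_edgeSegment hw)

lemma pos_eq_of_mem_other (huv : T.graph.Adj u v) {f} (hf : f ∈ T.graph.edgeSet)
    (hne : f ≠ s(u, v)) {z z'} (hz : z ∈ edgeSegment f) (hz' : z' ∈ edgeSegment f) :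
    T.pos u v z = T.pos u v z' := by
  induction f with | _ a b =>
  have ha : a ∈ s(a, b) := Sym2.mem_mk_left a b
  rw [pos_of_mem_other huv hf hne ha hz, pos_of_mem_other huv hf hne ha hz']

lemma dist_pos_le (huv : T.graph.Adj u v) {f} (hf : f ∈ T.graph.edgeSet)
    {z z'} (hz : z ∈ edgeSegment f) (hz' : z' ∈ edgeSegment f) :
    dist (T.pos u v z) (T.pos u v z') ≤ dist z z' := by
  by_cases hne : f = s(u, v)
  · subst hne
    rw [pos_of_mem hz, pos_of_mem hz', Real.dist_eq]
    exact abs_dist_sub_le _ _ _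
  · rw [pos_eq_of_mem_other huv hf hne hz hz', dist_self]
    exact dist_nonneg

lemma pos_mem_Icc (z) : T.pos u v z ∈ Set.Icc 0 (dist u v) := by
  rw [pos]
  split_ifs with h1 h2
  · refine ⟨dist_nonneg, ?_⟩
    obtain ⟨a, b, ha, hb, hab, rfl⟩ := h1
    rw [dist_eq_norm, dist_comm, dist_eq_norm]
    have : a • u + b • v - u = b • (v - u) := by
      rw [eq_sub_of_add_eq hab]; module
    rw [this, norm_smul, Real.norm_of_nonneg hb]
    exact mul_le_of_le_one_left (norm_nonneg _) (by linarith)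
  · exact ⟨dist_nonneg, le_rfl⟩
  · exact ⟨le_rfl, dist_nonneg⟩

/-- Distances are Euclidean, not measured along the tree. Disjoint edges are a positive distance
apart; adjacent ones meet at a positive angle, so a detour through the common vertex costs a bounded
factor. -/
lemma exists_dist_pos_le_mul (huv : T.graph.Adj u v) {f f'} (hf : f ∈ T.graph.edgeSet)
    (hf' : f' ∈ T.graph.edgeSet) :
    ∃ C : ℝ≥0, ∀ z ∈ edgeSegment f, ∀ z' ∈ edgeSegment f',
      dist (T.pos u v z) (T.pos u v z') ≤ C * dist z z' := by
  by_cases hff : f = f'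
  · subst hff
    exact ⟨1, fun z hz z' hz' => by simpa using dist_pos_le huv hf hz hz'⟩
  by_cases hdisj : Disjoint (edgeSegment f) (edgeSegment f')
  · obtain ⟨r, hr, h⟩ := Metric.exists_pos_forall_lt_edist (isCompact_edgeSegment f)
      (isCompact_edgeSegment f').isClosed hdisj
    refine ⟨nndist u v / r, fun z hz z' hz' => ?_⟩
    have h1 : (r : ℝ) < dist z z' := by
      have := h z hz z' hz'
      rw [edist_nndist, ENNReal.coe_lt_coe] at this
      exact_mod_cast this
    have h2 : dist (T.pos u v z) (T.pos u v z') ≤ dist u v := by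
      simpa using Real.dist_le_of_mem_Icc (T.pos_mem_Icc z) (T.pos_mem_Icc z')
    have hr' : (0 : ℝ) < r := hr
    push_cast
    rw [div_mul_eq_mul_div, le_div_iff₀ hr']
    gcongr
  · obtain ⟨a, ha, ha'⟩ := Set.not_disjoint_iff.1 hdisj
    obtain ⟨haf, haf'⟩ := T.embedded f hf f' hf' hff a ⟨ha, ha'⟩
    obtain ⟨b, rfl⟩ := haf
    obtain ⟨c, rfl⟩ := haf'
    obtain ⟨C, hC⟩ := exists_dist_add_dist_le_mul_dist (a := a) (b := b) (c := c)
      (T.graph.ne_of_adj hf).symm (T.graph.ne_of_adj hf').symm (by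
        intro z hz hz'
        obtain ⟨h1, h2⟩ := T.embedded _ hf _ hf' hff z ⟨hz, hz'⟩
        by_contra hza
        exact hff (((Sym2.mem_and_mem_iff hza).1 ⟨h1, Sym2.mem_mk_left _ _⟩).trans
          ((Sym2.mem_and_mem_iff hza).1 ⟨h2, Sym2.mem_mk_left _ _⟩).symm))
    refine ⟨C, fun z hz z' hz' => ?_⟩
    exact (dist_triangle _ (T.pos u v a) _).trans ((add_le_add (dist_pos_le huv hf hz ha)
      (dist_pos_le huv hf' ha' hz')).trans (hC z hz z' hz'))

lemma exists_lipschitzOnWith_pos (huv : T.graph.Adj u v) :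
    ∃ L, LipschitzOnWith L (T.pos u v) T.carrier := by
  have : Finite T.graph.edgeSet := T.finite_edges
  have := Fintype.ofFinite T.graph.edgeSet
  choose C hC using fun ff : T.graph.edgeSet × T.graph.edgeSet =>
    exists_dist_pos_le_mul huv ff.1.2 ff.2.2
  refine ⟨∑ ff, C ff, LipschitzOnWith.of_dist_le_mul fun z hz z' hz' => ?_⟩
  obtain ⟨f, hf, hzf⟩ := T.mem_carrier.1 hz
  obtain ⟨f', hf', hzf'⟩ := T.mem_carrier.1 hz'
  refine (hC (⟨f, hf⟩, ⟨f', hf'⟩) z hzf z' hzf').trans ?_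
  gcongr
  exact Finset.single_le_sum (f := C) (fun _ _ => zero_le) (Finset.mem_univ _)

lemma eventually_exists_common_edge (a) :
    ∀ᶠ b in 𝓝[T.carrier] a, ∃ f ∈ T.graph.edgeSet, a ∈ edgeSegment f ∧ b ∈ edgeSegment f := by
  have h : ∀ᶠ b in 𝓝[T.carrier] a, ∀ f ∈ T.graph.edgeSet, a ∉ edgeSegment f →
      b ∉ edgeSegment f := by
    refine (eventually_all_finite T.finite_edges).2 fun f _ => ?_
    by_cases haf : a ∈ edgeSegment f
    · exact Eventually.of_forall fun b h => absurd haf h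
    · have := (isCompact_edgeSegment f).isClosed.isOpen_compl.mem_nhds haf
      filter_upwards [mem_nhdsWithin_of_mem_nhds this] with b hb _ using hb
  filter_upwards [h, self_mem_nhdsWithin] with b hb hbT
  obtain ⟨f, hf, hbf⟩ := T.mem_carrier.1 hbT
  exact ⟨f, hf, by_contra fun haf => hb f hf haf hbf, hbf⟩

variable {x y : EuclideanSpace ℝ (Fin d)}

lemma orbit_subset : T.orbit x y ⊆ T.graph.edgeSet := by
  rintro e ⟨q, -, he⟩
  exact q.edges_subset_edgeSet he

lemma exists_endpoints (e : T.orbit x y) : ∃ uv : EuclideanSpace ℝ (Fin d) ×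
    EuclideanSpace ℝ (Fin d), e.1 = s(uv.1, uv.2) ∧ T.graph.Adj uv.1 uv.2 ∧
      ¬ T.Beyond uv.1 uv.2 x ∧ T.Beyond uv.1 uv.2 y := by
  obtain ⟨e, q, hq, he⟩ := e
  obtain ⟨u, v, h1, h2, h3, h4⟩ := exists_reachable_deleteEdges_of_mem_edges q hq.isTrail he
  exact ⟨(u, v), h1, h2, fun h => not_beyond_left h2 (h.trans h3), h4⟩

lemma exists_mem_edgeSet_left (h : (T.orbit x y).Nonempty) : ∃ f ∈ T.graph.edgeSet, x ∈ f := by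
  obtain ⟨e, q, -, he⟩ := h
  cases q with
  | nil => simp at he
  | cons h p => exact ⟨_, h, Sym2.mem_mk_left _ _⟩

lemma orbit_comm : T.orbit x y = T.orbit y x := by
  ext e
  constructor <;>
  · rintro ⟨q, hq, he⟩
    exact ⟨q.reverse, hq.reverse, by simpa using he⟩

lemma exists_mem_edgeSet_right (h : (T.orbit x y).Nonempty) :
    ∃ f ∈ T.graph.edgeSet, y ∈ f :=
  exists_mem_edgeSet_left (x := y) (y := x) (by rwa [orbit_comm])

lemma left_mem_carrier (h : (T.orbit x y).Nonempty) : x ∈ T.carrier := by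
  obtain ⟨f, hf, hx⟩ := exists_mem_edgeSet_left h
  exact T.edgeSegment_subset_carrier hf (mem_edgeSegment hx)

lemma right_mem_carrier (h : (T.orbit x y).Nonempty) : y ∈ T.carrier := by
  obtain ⟨f, hf, hx⟩ := exists_mem_edgeSet_right h
  exact T.edgeSegment_subset_carrier hf (mem_edgeSegment hx)

/-- The first and the second endpoint of an edge, in the order of the path from `x` to `y`. -/
def endpoints (e : T.orbit x y) : EuclideanSpace ℝ (Fin d) × EuclideanSpace ℝ (Fin d) :=
  (exists_endpoints e).choose

lemma endpoints_spec (e : T.orbit x y) :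
    e.1 = s((endpoints e).1, (endpoints e).2) ∧ T.graph.Adj (endpoints e).1 (endpoints e).2 ∧
      ¬ T.Beyond (endpoints e).1 (endpoints e).2 x ∧ T.Beyond (endpoints e).1 (endpoints e).2 y :=
  (exists_endpoints e).choose_spec

variable (T x y) in
/-- The positions along the edges of the path from `x` to `y`. -/
def slopeSystem : SlopeSystem T.carrier x y (T.orbit x y) where
  pot e := T.pos (endpoints e).1 (endpoints e).2
  piece e := edgeSegment e.1
  len e := edgeLength e.1
  isClosed_piece e := (isCompact_edgeSegment _).isClosed
  piece_subset e := T.edgeSegment_subset_carrier (orbit_subset e.2)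
  lipschitz e := exists_lipschitzOnWith_pos (endpoints_spec e).2.1
  pot_source e := by
    obtain ⟨-, h2, h3, -⟩ := endpoints_spec e
    obtain ⟨f, hf, hx⟩ := exists_mem_edgeSet_left ⟨e.1, e.2⟩
    rw [pos_vertex h2 hf hx, if_neg h3]
  pot_target e := by
    obtain ⟨h1, h2, -, h4⟩ := endpoints_spec e
    obtain ⟨f, hf, hy⟩ := exists_mem_edgeSet_right ⟨e.1, e.2⟩
    rw [pos_vertex h2 hf hy, if_pos h4, h1, edgeLength_mk, coe_nndist]
  slope a _ := by
    filter_upwards [eventually_exists_common_edge a] with b ⟨f, hf, haf, hbf⟩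
    have hother : ∀ e : T.orbit x y, e.1 ≠ f →
        T.pos (endpoints e).1 (endpoints e).2 b = T.pos (endpoints e).1 (endpoints e).2 a :=
      fun e he => by
        obtain ⟨h1, h2, -⟩ := endpoints_spec e
        exact pos_eq_of_mem_other h2 hf (fun h => he (h1.trans h.symm)) hbf haf
    by_cases hfo : f ∈ T.orbit x y
    · right
      exact ⟨⟨f, hfo⟩, haf, dist_pos_le (endpoints_spec _).2.1 hf hbf haf,
        fun j hj => hother j fun h => hj (Subtype.ext h)⟩
    · left
      exact fun e => hother e fun h => hfo (h ▸ e.2)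

lemma edgeLength_ne_zero {e} (he : e ∈ T.graph.edgeSet) : edgeLength e ≠ 0 := by
  induction e with | _ u v =>
  rw [edgeLength_mk, ne_eq, nndist_eq_zero]
  exact T.graph.ne_of_adj he

end TreeNetwork

end Network

/-! ### Curves parametrized by mass and the upper bound. -/

section QuantileCurve

lemma rpow_lintegral_le_mul_lintegral_rpow {Ω : Type*} [MeasurableSpace Ω] (P : Measure Ω)
    {p : ℝ} (hp : 1 < p) {f : Ω → ℝ≥0∞} (hf : AEMeasurable f P) :
    (∫⁻ ω, f ω ∂P) ^ p ≤ P Set.univ ^ (p - 1) * ∫⁻ ω, f ω ^ p ∂P := by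
  have hp0 : 0 < p := by linarith
  have hpq := Real.HolderConjugate.conjExponent hp
  have h := ENNReal.lintegral_mul_le_Lp_mul_Lq P hpq hf (aemeasurable_const (b := (1 : ℝ≥0∞)))
  have h' := ENNReal.rpow_le_rpow h hp0.le
  simp only [Pi.mul_apply, mul_one, ENNReal.one_rpow, lintegral_one] at h'
  rw [ENNReal.mul_rpow_of_nonneg _ _ hp0.le, ← ENNReal.rpow_mul, one_div_mul_cancel hp0.ne',
    ENNReal.rpow_one, ← ENNReal.rpow_mul] at h'
  have e : 1 / p.conjExponent * p = p - 1 := by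
    rw [one_div_mul_eq_div]; exact hpq.div_conj_eq_sub_one
  rwa [e, mul_comm] at h'

variable {X : Type*} [MeasurableSpace X] [PseudoEMetricSpace X]

/-- `Q` runs from `x` to `y` in such a way that `ν` is the image of Lebesgue measure on `[0, m]`,
with speed at most `h`. -/
structure IsQuantileCurve (ν : Measure X) (x y : X) (m : ℝ) (Q : ℝ → X) (h : ℝ → ℝ≥0∞) :
    Prop where
  nonneg : 0 ≤ m
  measurable_curve : Measurable Q
  measurable_speed : Measurable h
  eq_source : ∀ t ≤ 0, Q t = x
  eq_target : ∀ t, m ≤ t → Q t = y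
  edist_le : ∀ a b, a ≤ b → edist (Q a) (Q b) ≤ ∫⁻ t in Set.Ioc a b, h t
  map_eq : (volume.restrict (Set.Ioc 0 m)).map Q = ν

lemma isQuantileCurve_const (x : X) : IsQuantileCurve 0 x x 0 (fun _ => x) 0 where
  nonneg := le_rfl
  measurable_curve := measurable_const
  measurable_speed := measurable_const
  eq_source _ _ := rfl
  eq_target _ _ := rfl
  edist_le a b _ := by simp
  map_eq := by simp

lemma map_sub_restrict_Ioc (a b c : ℝ) :
    (volume.restrict (Set.Ioc (a + c) (b + c))).map (fun t => t - c) =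
      volume.restrict (Set.Ioc a b) := by
  have h : MeasurePreserving (fun t : ℝ => t - c) volume volume :=
    measurePreserving_sub_right volume c
  have := h.restrict_preimage (s := Set.Ioc a b) measurableSet_Ioc
  rw [Set.preimage_sub_const_Ioc] at this
  exact this.map_eq

lemma lintegral_Ioc_sub (h : ℝ → ℝ≥0∞) (hh : Measurable h) (a b c : ℝ) :
    ∫⁻ t in Set.Ioc a b, h t = ∫⁻ t in Set.Ioc (a + c) (b + c), h (t - c) := by
  rw [← map_sub_restrict_Ioc a b c, lintegral_map hh (by fun_prop)]

/-- The curves fit at time m₁ because each is constant outside its own mass interval. -/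
lemma IsQuantileCurve.concat {ν₁ ν₂ : Measure X} {x y z : X} {m₁ m₂ : ℝ} {Q₁ Q₂ : ℝ → X}
    {h₁ h₂ : ℝ → ℝ≥0∞} (H₁ : IsQuantileCurve ν₁ x z m₁ Q₁ h₁)
    (H₂ : IsQuantileCurve ν₂ z y m₂ Q₂ h₂) :
    IsQuantileCurve (ν₁ + ν₂) x y (m₁ + m₂) (fun t => if t ≤ m₁ then Q₁ t else Q₂ (t - m₁))
      (fun t => if t ≤ m₁ then h₁ t else h₂ (t - m₁)) := by
  have hQ2 : ∀ t, m₁ ≤ t → (if t ≤ m₁ then Q₁ t else Q₂ (t - m₁)) = Q₂ (t - m₁) := by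
    intro t ht
    split_ifs with h
    · rw [H₁.eq_target t ht, H₂.eq_source _ (by linarith)]
    · rfl
  have hm₁ := H₁.nonneg
  have hm₂ := H₂.nonneg
  refine ⟨by linarith, ?_, ?_, ?_, ?_, ?_, ?_⟩
  · exact Measurable.ite measurableSet_Iic H₁.measurable_curve
      (H₂.measurable_curve.comp (by fun_prop))
  · exact Measurable.ite measurableSet_Iic H₁.measurable_speed
      (H₂.measurable_speed.comp (by fun_prop))
  · intro t ht
    rw [if_pos (by linarith), H₁.eq_source t ht]
  · intro t ht
    rw [hQ2 t (by linarith), H₂.eq_target _ (by linarith)]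
  · have low : ∀ a b, a ≤ b → b ≤ m₁ →
        edist (if a ≤ m₁ then Q₁ a else Q₂ (a - m₁)) (if b ≤ m₁ then Q₁ b else Q₂ (b - m₁)) ≤
          ∫⁻ t in Set.Ioc a b, if t ≤ m₁ then h₁ t else h₂ (t - m₁) := by
      intro a b hab hb
      rw [if_pos hb, if_pos (hab.trans hb)]
      refine (H₁.edist_le a b hab).trans (le_of_eq ?_)
      refine setLIntegral_congr_fun measurableSet_Ioc fun t ht => ?_
      simp only [if_pos (ht.2.trans hb)]
    have high : ∀ a b, a ≤ b → m₁ ≤ a →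
        edist (if a ≤ m₁ then Q₁ a else Q₂ (a - m₁)) (if b ≤ m₁ then Q₁ b else Q₂ (b - m₁)) ≤
          ∫⁻ t in Set.Ioc a b, if t ≤ m₁ then h₁ t else h₂ (t - m₁) := by
      intro a b hab ha
      rw [hQ2 a ha, hQ2 b (ha.trans hab)]
      refine (H₂.edist_le _ _ (by linarith)).trans (le_of_eq ?_)
      rw [lintegral_Ioc_sub h₂ H₂.measurable_speed _ _ m₁, sub_add_cancel, sub_add_cancel]
      refine setLIntegral_congr_fun measurableSet_Ioc fun t ht => ?_
      simp only [if_neg (not_le.2 (ha.trans_lt ht.1))]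
    intro a b hab
    rcases le_total b m₁ with hb | hb
    · exact low a b hab hb
    rcases le_total m₁ a with ha | ha
    · exact high a b hab ha
    refine (edist_triangle _ (if m₁ ≤ m₁ then Q₁ m₁ else Q₂ (m₁ - m₁)) _).trans ?_
    rw [← Set.Ioc_union_Ioc_eq_Ioc ha hb,
      lintegral_union measurableSet_Ioc (Set.Ioc_disjoint_Ioc_of_le le_rfl)]
    exact add_le_add (low a m₁ ha le_rfl) (high m₁ b hb le_rfl)
  · have hmeas : Measurable fun t => if t ≤ m₁ then Q₁ t else Q₂ (t - m₁) :=
      Measurable.ite measurableSet_Iic H₁.measurable_curve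
        (H₂.measurable_curve.comp (by fun_prop))
    rw [← Set.Ioc_union_Ioc_eq_Ioc hm₁ (by linarith : m₁ ≤ m₁ + m₂),
      Measure.restrict_union (Set.Ioc_disjoint_Ioc_of_le le_rfl) measurableSet_Ioc,
      Measure.map_add _ _ hmeas]
    congr 1
    · rw [← H₁.map_eq]
      refine Measure.map_congr ?_
      filter_upwards [ae_restrict_mem measurableSet_Ioc] with t ht
      rw [if_pos ht.2]
    · rw [← H₂.map_eq, ← map_sub_restrict_Ioc 0 m₂ m₁,
        Measure.map_map H₂.measurable_curve (by fun_prop), zero_add, add_comm m₂]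
      refine Measure.map_congr ?_
      filter_upwards [ae_restrict_mem measurableSet_Ioc] with t ht
      exact hQ2 t ht.1.le

lemma lintegral_rpow_concat_le {p : ℝ} {m₁ : ℝ} {h₁ h₂ : ℝ → ℝ≥0∞} :
    ∫⁻ t, (if t ≤ m₁ then h₁ t else h₂ (t - m₁)) ^ p ≤
      (∫⁻ t, h₁ t ^ p) + ∫⁻ t, h₂ t ^ p := by
  refine (lintegral_add_compl (fun t => (if t ≤ m₁ then h₁ t else h₂ (t - m₁)) ^ p)
    (measurableSet_Iic (a := m₁))).symm.le.trans (add_le_add ?_ ?_)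
  · calc _ = ∫⁻ t in Set.Iic m₁, h₁ t ^ p :=
          setLIntegral_congr_fun measurableSet_Iic fun t (ht : t ≤ m₁) => by simp only [if_pos ht]
      _ ≤ _ := setLIntegral_le_lintegral _ _
  · calc _ = ∫⁻ t in (Set.Iic m₁)ᶜ, h₂ (t - m₁) ^ p :=
          setLIntegral_congr_fun measurableSet_Iic.compl fun t (ht : ¬ t ≤ m₁) => by
            simp only [if_neg ht]
      _ ≤ ∫⁻ t, h₂ (t - m₁) ^ p := setLIntegral_le_lintegral _ _
      _ = _ := lintegral_sub_right_eq_self (fun t => h₂ t ^ p) m₁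

/-- The extra time ε is spent at y. For the shifted curve below it is spent at x, so Q(t - ε) ↦ Q(t)
is a plan for the perturbed measures. -/
lemma IsQuantileCurve.map_restrict_of_le {ν : Measure X} {x y : X} {m : ℝ} {Q : ℝ → X}
    {h : ℝ → ℝ≥0∞} (H : IsQuantileCurve ν x y m Q h) (ε : ℝ≥0) :
    (volume.restrict (Set.Ioc 0 (m + ε))).map Q = ν + ε • Measure.dirac y := by
  rw [← Set.Ioc_union_Ioc_eq_Ioc H.nonneg (by linarith [ε.2] : m ≤ m + ε),
    Measure.restrict_union (Set.Ioc_disjoint_Ioc_of_le le_rfl) measurableSet_Ioc,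
    Measure.map_add _ _ H.measurable_curve, H.map_eq]
  congr 1
  have : (volume.restrict (Set.Ioc m (m + ε))).map Q =
      (volume.restrict (Set.Ioc m (m + ε))).map fun _ => y := by
    refine Measure.map_congr ?_
    filter_upwards [ae_restrict_mem measurableSet_Ioc] with t ht
    exact H.eq_target t ht.1.le
  rw [this, Measure.map_const]
  simp

lemma IsQuantileCurve.map_restrict_sub {ν : Measure X} {x y : X} {m : ℝ} {Q : ℝ → X}
    {h : ℝ → ℝ≥0∞} (H : IsQuantileCurve ν x y m Q h) (ε : ℝ≥0) :
    (volume.restrict (Set.Ioc 0 (m + ε))).map (fun t => Q (t - ε)) =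
      ν + ε • Measure.dirac x := by
  have hε : (0 : ℝ) ≤ ε := ε.2
  have hm := H.nonneg
  have hmeas : Measurable fun t => Q (t - ε) := H.measurable_curve.comp (by fun_prop)
  rw [← Set.Ioc_union_Ioc_eq_Ioc hε (by linarith : (ε : ℝ) ≤ m + ε),
    Measure.restrict_union (Set.Ioc_disjoint_Ioc_of_le le_rfl) measurableSet_Ioc,
    Measure.map_add _ _ hmeas, add_comm]
  congr 1
  · rw [← H.map_eq, ← map_sub_restrict_Ioc 0 m ε,
      Measure.map_map H.measurable_curve (by fun_prop), zero_add]
    rfl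
  · have : (volume.restrict (Set.Ioc 0 (ε : ℝ))).map (fun t => Q (t - ε)) =
        (volume.restrict (Set.Ioc 0 (ε : ℝ))).map fun _ => x := by
      refine Measure.map_congr ?_
      filter_upwards [ae_restrict_mem measurableSet_Ioc] with t ht
      exact H.eq_source _ (by linarith [ht.2])
    rw [this, Measure.map_const]
    simp

/-- By Hölder the p-th power of the integral of h over (t-ε, t] is at most ε^{p-1} times the
integral of h^p; Tonelli and translation invariance supply the remaining factor ε. -/
lemma IsQuantileCurve.lintegral_edist_rpow_le {ν : Measure X} {x y : X} {m : ℝ} {Q : ℝ → X}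
    {h : ℝ → ℝ≥0∞} (H : IsQuantileCurve ν x y m Q h) {p : ℝ} (hp : 1 < p) (ε : ℝ≥0) :
    ∫⁻ t, edist (Q (t - ε)) (Q t) ^ p ≤ (ε : ℝ≥0∞) ^ p * ∫⁻ t, h t ^ p := by
  have hp0 : 0 < p := by linarith
  have hh := H.measurable_speed
  have hsub : ∀ t : ℝ, ∫⁻ r in Set.Ioc (t - ε) t, h r = ∫⁻ r in Set.Ico 0 (ε : ℝ), h (t - r) := by
    intro t
    rw [← lintegral_indicator measurableSet_Ioc, ← lintegral_indicator measurableSet_Ico,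
      ← lintegral_sub_left_eq_self _ t]
    congr 1 with r
    by_cases hr : r ∈ Set.Ico 0 (ε : ℝ)
    · rw [Set.indicator_of_mem hr, Set.indicator_of_mem]
      exact ⟨by linarith [hr.2], by linarith [hr.1]⟩
    · rw [Set.indicator_of_notMem hr, Set.indicator_of_notMem]
      exact fun h' => hr ⟨by linarith [h'.2], by linarith [h'.1]⟩
  calc ∫⁻ t, edist (Q (t - ε)) (Q t) ^ p
      ≤ ∫⁻ t, (ε : ℝ≥0∞) ^ (p - 1) * ∫⁻ r in Set.Ico 0 (ε : ℝ), h (t - r) ^ p := by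
        refine lintegral_mono fun t => ?_
        refine (ENNReal.rpow_le_rpow (H.edist_le (t - ε) t (by linarith [ε.2])) hp0.le).trans ?_
        rw [hsub]
        refine (rpow_lintegral_le_mul_lintegral_rpow _ hp (by fun_prop)).trans (le_of_eq ?_)
        simp
    _ = (ε : ℝ≥0∞) ^ (p - 1) * ∫⁻ r in Set.Ico 0 (ε : ℝ), ∫⁻ t, h (t - r) ^ p := by
        have hm2 : Measurable fun z : ℝ × ℝ => h (z.1 - z.2) ^ p := by fun_prop
        rw [lintegral_const_mul _ hm2.lintegral_prod_right', lintegral_lintegral_swap]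
        exact hm2.aemeasurable
    _ = (ε : ℝ≥0∞) ^ (p - 1) * (ε * ∫⁻ t, h t ^ p) := by
        congr 1
        simp_rw [lintegral_sub_right_eq_self (fun t => h t ^ p)]
        rw [setLIntegral_const]
        simp [mul_comm]
    _ = _ := by
        rw [← mul_assoc]
        congr 1
        by_cases hε : ε = 0
        · simp [hε, hp0]
        conv_lhs => rw [← ENNReal.rpow_one (ε : ℝ≥0∞), ← ENNReal.rpow_mul, one_mul,
          ← ENNReal.rpow_add _ _ (by simpa using hε) (by simp), sub_add_cancel]

/-- Moving along a quantile curve bounds the Wasserstein distance from above. -/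
lemma IsQuantileCurve.wasserstein_le [OpensMeasurableSpace X] [SecondCountableTopology X]
    {ν : Measure X} {x y : X} {m : ℝ} {Q : ℝ → X}
    {h : ℝ → ℝ≥0∞} (H : IsQuantileCurve ν x y m Q h) {p : ℝ} (hp : 1 < p) (ε : ℝ≥0) :
    wasserstein p (ν + ε • Measure.dirac x) (ν + ε • Measure.dirac y) ≤
      ε * (∫⁻ t, h t ^ p) ^ (1 / p) := by
  have hp0 : 0 < p := by linarith
  have hQ := H.measurable_curve
  have hQε : Measurable fun t => Q (t - ε) := hQ.comp (by fun_prop)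
  have hplan := isTransportPlan_map (volume.restrict (Set.Ioc 0 (m + ε))) hQε hQ
  rw [H.map_restrict_of_le, H.map_restrict_sub] at hplan
  refine (GilbertMailing.wasserstein_le hp0 hplan).trans ?_
  rw [lintegral_map (by fun_prop) (by fun_prop)]
  have h1 := (setLIntegral_le_lintegral (Set.Ioc 0 (m + ε)) _).trans
    (H.lintegral_edist_rpow_le hp ε)
  refine (ENNReal.rpow_le_rpow h1 (by positivity)).trans (le_of_eq ?_)
  rw [ENNReal.mul_rpow_of_nonneg _ _ (by positivity), ← ENNReal.rpow_mul,
    mul_one_div_cancel hp0.ne', ENNReal.rpow_one]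

end QuantileCurve

/-! ### Arc length on a segment and measures proportional to it. -/

section SegmentMeasure

variable {E : Type*} [NormedAddCommGroup E] [NormedSpace ℝ E]

/-- The unit speed parametrization of the line through `u` and `v`. -/
def unitSpeed (u v : E) (r : ℝ) : E := u + r • (‖v - u‖⁻¹ • (v - u))

lemma isometry_unitSpeed {u v : E} (h : u ≠ v) : Isometry (unitSpeed u v) := by
  refine Isometry.of_dist_eq fun a b => ?_
  have hn : ‖v - u‖ ≠ 0 := norm_ne_zero_iff.2 (sub_ne_zero.2 h.symm)
  rw [unitSpeed, unitSpeed, dist_add_left, dist_eq_norm, ← sub_smul, norm_smul, norm_smul,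
    norm_inv, norm_norm, inv_mul_cancel₀ hn, mul_one, dist_eq_norm]

lemma unitSpeed_zero (u v : E) : unitSpeed u v 0 = u := by simp [unitSpeed]

lemma unitSpeed_dist {u v : E} (h : u ≠ v) : unitSpeed u v (dist u v) = v := by
  have hn : ‖v - u‖ ≠ 0 := norm_ne_zero_iff.2 (sub_ne_zero.2 h.symm)
  rw [unitSpeed, dist_comm, dist_eq_norm, smul_smul, mul_inv_cancel₀ hn, one_smul]
  abel

lemma unitSpeed_preimage_segment {u v : E} (h : u ≠ v) :
    unitSpeed u v ⁻¹' segment ℝ u v = Set.Icc 0 (dist u v) := by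
  have hn : 0 < ‖v - u‖ := norm_pos_iff.2 (sub_ne_zero.2 h.symm)
  ext r
  rw [Set.mem_preimage, segment_eq_image', dist_comm, dist_eq_norm]
  constructor
  · rintro ⟨t, ⟨ht0, ht1⟩, ht⟩
    have h1 : t • (v - u) = (r * ‖v - u‖⁻¹) • (v - u) := by
      rw [mul_smul]; exact add_left_cancel ht
    have h2 : t = r * ‖v - u‖⁻¹ := smul_left_injective ℝ (sub_ne_zero.2 h.symm) h1
    have h3 : r = t * ‖v - u‖ := by rw [h2, inv_mul_cancel_right₀ hn.ne']
    rw [h3]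
    exact ⟨by positivity, mul_le_of_le_one_left hn.le ht1⟩
  · rintro ⟨h0, h1⟩
    refine ⟨r * ‖v - u‖⁻¹, ⟨by positivity, ?_⟩, ?_⟩
    · rw [← div_eq_mul_inv]; exact (div_le_one hn).2 h1
    · simp only [unitSpeed, mul_smul]

lemma segment_subset_range_unitSpeed {u v : E} (h : u ≠ v) :
    segment ℝ u v ⊆ Set.range (unitSpeed u v) := by
  have hn : ‖v - u‖ ≠ 0 := norm_ne_zero_iff.2 (sub_ne_zero.2 h.symm)
  rw [segment_eq_image']
  rintro _ ⟨t, -, rfl⟩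
  exact ⟨t * ‖v - u‖, by simp only [unitSpeed, smul_smul, mul_assoc, mul_inv_cancel₀ hn, mul_one]⟩

lemma dist_unitSpeed_left {u v : E} (h : u ≠ v) {r : ℝ} (hr : 0 ≤ r) :
    dist (unitSpeed u v r) u = r := by
  conv_lhs => rw [← unitSpeed_zero u v]
  have := (isometry_unitSpeed h).dist_eq r 0
  rw [unitSpeed_zero] at this
  rw [unitSpeed_zero, this]
  simp [abs_of_nonneg hr]

lemma unitSpeed_dist_of_mem_segment {u v z : E} (h : u ≠ v) (hz : z ∈ segment ℝ u v) :
    unitSpeed u v (dist z u) = z := by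
  obtain ⟨r, rfl⟩ := segment_subset_range_unitSpeed h hz
  have hr : r ∈ unitSpeed u v ⁻¹' segment ℝ u v := hz
  rw [unitSpeed_preimage_segment h] at hr
  rw [dist_unitSpeed_left h hr.1]

lemma measurableSet_segment [MeasurableSpace E] [BorelSpace E] (u v : E) :
    MeasurableSet (segment ℝ u v) := by
  rw [segment_eq_image_lineMap]
  exact (isCompact_Icc.image (by fun_prop)).measurableSet

lemma map_unitSpeed_restrict_Icc [MeasurableSpace E] [BorelSpace E] {u v : E} (h : u ≠ v) :
    (volume.restrict (Set.Icc 0 (dist u v))).map (unitSpeed u v) =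
      (Measure.hausdorffMeasure 1).restrict (segment ℝ u v) := by
  have hi := isometry_unitSpeed h
  rw [← unitSpeed_preimage_segment h,
    ← Measure.restrict_map hi.continuous.measurable (measurableSet_segment u v),
    ← hausdorffMeasure_real, hi.map_hausdorffMeasure (Or.inl zero_le_one),
    Measure.restrict_restrict (measurableSet_segment u v),
    Set.inter_eq_left.2 (segment_subset_range_unitSpeed h)]

/-- Moving along a segment whose mass is uniformly distributed. -/
lemma isQuantileCurve_segment [MeasurableSpace E] [BorelSpace E] {u v : E} (h : u ≠ v) {s : ℝ≥0}
    (hs : s ≠ 0) :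
    IsQuantileCurve (s • (Measure.hausdorffMeasure 1).restrict (segment ℝ u v)) u v
      (dist u v * s) (fun t => unitSpeed u v (max 0 (min (t / s) (dist u v))))
      ((Set.Ioc 0 (dist u v * s)).indicator fun _ => (s : ℝ≥0∞)⁻¹) := by
  have hi := isometry_unitSpeed h
  have hs0 : (0 : ℝ) < s := by exact_mod_cast pos_iff_ne_zero.2 hs
  have hl : 0 ≤ dist u v := dist_nonneg
  have hcont : Continuous fun t : ℝ => unitSpeed u v (max 0 (min (t / s) (dist u v))) :=
    hi.continuous.comp (by fun_prop)
  refine ⟨by positivity, hcont.measurable, measurable_const.indicator measurableSet_Ioc,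
    ?_, ?_, ?_, ?_⟩
  · intro t ht
    have : t / s ≤ 0 := div_nonpos_of_nonpos_of_nonneg ht hs0.le
    rw [max_eq_left ((min_le_left _ _).trans this), unitSpeed_zero]
  · intro t ht
    have : dist u v ≤ t / s := (le_div_iff₀ hs0).2 ht
    rw [min_eq_right this, max_eq_right hl, unitSpeed_dist h]
  · intro a b hab
    rw [hi.edist_eq, setLIntegral_indicator measurableSet_Ioc, setLIntegral_const,
      Set.Ioc_inter_Ioc, Real.volume_Ioc, edist_comm, edist_dist, Real.dist_eq,
      ← ENNReal.ofReal_coe_nnreal, ← ENNReal.ofReal_inv_of_pos hs0,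
      ← ENNReal.ofReal_mul (by positivity)]
    have hab' : a / s ≤ b / s := by gcongr
    have e1 : min (dist u v * s) b / s = min (dist u v) (b / s) := by
      rw [← min_div_div_right hs0.le, mul_div_cancel_right₀ _ hs0.ne']
    have e2 : max 0 a / s = max 0 (a / s) := by
      rw [← max_div_div_right hs0.le, zero_div]
    rw [abs_of_nonneg (sub_nonneg.2 (by gcongr)), inv_mul_eq_div, sub_div, e1, e2,
      ENNReal.ofReal_le_ofReal_iff']
    rcases le_total (b / s) 0 with hb | hb
    · right
      rw [max_eq_left ((min_le_left _ _).trans hb),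
        max_eq_left ((min_le_left _ _).trans (hab'.trans hb)), sub_self]
    rcases le_total (dist u v) (a / s) with ha | ha
    · right
      rw [min_eq_right ha, min_eq_right (ha.trans hab'), sub_self]
    · left
      rw [min_eq_left ha, max_eq_right (le_min hb hl), min_comm]
  · have e1 : (volume.restrict (Set.Ioc 0 (dist u v * s))).map (fun t : ℝ => t / s) =
        s • volume.restrict (Set.Icc 0 (dist u v)) := by
      have hpre : (fun t : ℝ => t / s) ⁻¹' Set.Ioc 0 (dist u v) = Set.Ioc 0 (dist u v * s) := by
        ext t
        simp only [Set.mem_preimage, Set.mem_Ioc, div_le_iff₀ hs0]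
        rw [div_pos_iff_of_pos_right hs0]
      have hvol : (volume : Measure ℝ).map (fun t : ℝ => t / s) = s • volume := by
        have := Real.map_volume_mul_right (a := (s : ℝ)⁻¹) (by positivity)
        simp only [← div_eq_mul_inv, inv_inv, abs_of_pos hs0] at this
        rw [this, ENNReal.ofReal_coe_nnreal]
        rfl
      rw [← hpre, ← Measure.restrict_map (by fun_prop) measurableSet_Ioc, hvol,
        Measure.restrict_smul, Measure.restrict_congr_set Ioc_ae_eq_Icc]
    have e2 : (volume.restrict (Set.Ioc 0 (dist u v * s))).map
        (fun t : ℝ => unitSpeed u v (max 0 (min (t / s) (dist u v)))) =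
        ((volume.restrict (Set.Ioc 0 (dist u v * s))).map (fun t : ℝ => t / s)).map
          (unitSpeed u v) := by
      rw [Measure.map_map hi.continuous.measurable (by fun_prop)]
      refine Measure.map_congr ?_
      filter_upwards [ae_restrict_mem measurableSet_Ioc] with t ht
      have h1 : t / s ≤ dist u v := (div_le_iff₀ hs0).2 ht.2
      have h2 : 0 ≤ t / s := div_nonneg ht.1.le hs0.le
      rw [Function.comp_apply, min_eq_left h1, max_eq_right h2]
    rw [e2, e1, Measure.map_smul, map_unitSpeed_restrict_Icc h]

lemma lintegral_speed_segment {l : ℝ≥0} {s : ℝ≥0} (hs : s ≠ 0) {p : ℝ} (hp : 0 < p) :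
    ∫⁻ t, ((Set.Ioc 0 ((l : ℝ) * s)).indicator (fun _ => (s : ℝ≥0∞)⁻¹) t) ^ p =
      l * (s : ℝ≥0∞) ^ (1 - p) := by
  have h : ∀ t, ((Set.Ioc 0 ((l : ℝ) * s)).indicator (fun _ => (s : ℝ≥0∞)⁻¹) t) ^ p =
      (Set.Ioc 0 ((l : ℝ) * s)).indicator (fun _ => ((s : ℝ≥0∞)⁻¹) ^ p) t := by
    intro t
    by_cases ht : t ∈ Set.Ioc 0 ((l : ℝ) * s)
    · rw [Set.indicator_of_mem ht, Set.indicator_of_mem ht]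
    · rw [Set.indicator_of_notMem ht, Set.indicator_of_notMem ht, ENNReal.zero_rpow_of_pos hp]
  simp_rw [h]
  rw [lintegral_indicator measurableSet_Ioc, setLIntegral_const, Real.volume_Ioc, sub_zero,
    ← NNReal.coe_mul, ENNReal.ofReal_coe_nnreal, ENNReal.coe_mul, mul_comm, mul_assoc]
  congr 1
  rw [sub_eq_add_neg, ENNReal.rpow_add _ _ (by simpa using hs) (by simp), ENNReal.rpow_one,
    ENNReal.inv_rpow, ENNReal.rpow_neg]

/-- A finite measure on a segment whose mass on initial pieces is proportional to the length is a
multiple of arc length. -/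
lemma restrict_segment_eq_smul_hausdorffMeasure [MeasurableSpace E] [BorelSpace E] {u v : E}
    (h : u ≠ v) (μ : Measure E) [IsFiniteMeasure μ] {s : ℝ≥0}
    (htot : μ (segment ℝ u v) = nndist u v * s)
    (hμ : ∀ l : ℝ≥0, 0 < l → l < nndist u v → μ (segment ℝ u v ∩ {z | dist z u = l}) = 0 →
      μ (segment ℝ u v ∩ {z | dist z u ≤ l}) = l * s) :
    μ.restrict (segment ℝ u v) = s • (Measure.hausdorffMeasure 1).restrict (segment ℝ u v) := by
  have hi := isometry_unitSpeed h
  set ℓ : ℝ≥0 := nndist u v with hℓ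
  have hm : Measurable fun z : E => dist z u := by fun_prop
  have hsm := measurableSet_segment (E := E) u v
  set M := (μ.restrict (segment ℝ u v)).map fun z => dist z u with hM
  have hMapply : ∀ A : Set ℝ, MeasurableSet A →
      M A = μ (segment ℝ u v ∩ (fun z => dist z u) ⁻¹' A) := by
    intro A hA
    rw [hM, Measure.map_apply hm hA, Measure.restrict_apply (hm hA), Set.inter_comm]
  have hMfin : IsFiniteMeasure M := by rw [hM]; infer_instance
  have hback : M.map (unitSpeed u v) = μ.restrict (segment ℝ u v) := by
    rw [hM, Measure.map_map hi.continuous.measurable hm]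
    conv_rhs => rw [← Measure.map_id (μ := μ.restrict (segment ℝ u v))]
    refine Measure.map_congr ?_
    filter_upwards [ae_restrict_mem hsm] with z hz
    exact unitSpeed_dist_of_mem_segment h hz
  have hle : ∀ z ∈ segment ℝ u v, dist z u ≤ ℓ := by
    intro z hz
    obtain ⟨r, rfl⟩ := segment_subset_range_unitSpeed h hz
    have hr : r ∈ unitSpeed u v ⁻¹' segment ℝ u v := hz
    rw [unitSpeed_preimage_segment h] at hr
    rw [dist_unitSpeed_left h hr.1]
    exact hr.2
  -- A finite measure has countably many atoms, so the radii at which the hypothesis applies are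
  -- dense in (0, ℓ). Monotonicity of the distribution function and continuity of r ↦ rs then settle
  -- all radii.
  have hcount : {r : ℝ | M {r} ≠ 0}.Countable := by
    have := Measure.countable_meas_level_set_pos (μ := M) (g := (id : ℝ → ℝ)) measurable_id
    simpa [pos_iff_ne_zero, Set.ofPred_eq_eq_singleton] using this
  have hdense : Dense {r : ℝ | M {r} ≠ 0}ᶜ := hcount.dense_compl ℝ
  have hgood : ∀ r : ℝ, 0 < r → r < ℓ → M {r} = 0 → M (Set.Iic r) = ENNReal.ofReal (r * s) := by
    intro r hr0 hrl hr
    lift r to ℝ≥0 using hr0.le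
    rw [hMapply _ measurableSet_Iic]
    rw [hMapply _ (measurableSet_singleton _)] at hr
    rw [← NNReal.coe_mul, ENNReal.ofReal_coe_nnreal, ENNReal.coe_mul]
    exact hμ r (by exact_mod_cast hr0) (by exact_mod_cast hrl) hr
  have hMs : M = s • volume.restrict (Set.Icc 0 (ℓ : ℝ)) := by
    refine Measure.ext_of_Iic _ _ fun r => ?_
    have hR : (s • volume.restrict (Set.Icc 0 (ℓ : ℝ))) (Set.Iic r) =
        ENNReal.ofReal (min r ℓ * s) := by
      have hinter : Set.Iic r ∩ Set.Icc 0 (ℓ : ℝ) = Set.Icc 0 (min r ℓ) := by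
        ext t
        simp only [Set.mem_inter_iff, Set.mem_Iic, Set.mem_Icc, le_min_iff]
        tauto
      rw [Measure.smul_apply, Measure.restrict_apply measurableSet_Iic, hinter,
        Real.volume_Icc, sub_zero, ENNReal.ofReal_mul' s.coe_nonneg,
        ENNReal.ofReal_coe_nnreal, mul_comm]
      rfl
    rw [hR]
    rcases le_or_gt (ℓ : ℝ) r with hr | hr
    · rw [min_eq_right hr, hMapply _ measurableSet_Iic, Set.inter_eq_left.2, htot,
        ← NNReal.coe_mul, ENNReal.ofReal_coe_nnreal, ENNReal.coe_mul]
      exact fun z hz => (hle z hz).trans hr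
    rw [min_eq_left hr.le]
    have hcont : Continuous fun r : ℝ => ENNReal.ofReal (r * s) :=
      ENNReal.continuous_ofReal.comp (by fun_prop)
    apply le_antisymm
    · rcases lt_or_ge r 0 with hr0 | hr0
      · rw [hMapply _ measurableSet_Iic]
        refine (le_of_eq ?_).trans zero_le
        convert measure_empty (μ := μ)
        refine Set.eq_empty_of_forall_notMem fun z hz => ?_
        exact absurd (dist_nonneg.trans hz.2) (not_le.2 hr0)
      by_contra hcon
      have hev := ((hcont.tendsto r).eventually (gt_mem_nhds (not_le.1 hcon)))
      obtain ⟨r₁, hr₁, hsub⟩ := (mem_nhdsGT_iff_exists_Ioo_subset' hr).1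
        (inter_mem (mem_nhdsWithin_of_mem_nhds hev) (Ioo_mem_nhdsGT hr))
      obtain ⟨c, hc, hrc, hcr⟩ := hdense.exists_between hr₁
      have h1 := hsub ⟨hrc, hcr⟩
      have h2 := hgood c (hr0.trans_lt hrc) h1.2.2 (not_not.1 hc)
      have h3 : M (Set.Iic r) ≤ M (Set.Iic c) := measure_mono (Set.Iic_subset_Iic.2 hrc.le)
      rw [h2] at h3
      exact absurd h1.1 (not_lt.2 h3)
    · rcases le_or_gt r 0 with hr0 | hr0
      · rw [ENNReal.ofReal_of_nonpos (mul_nonpos_of_nonpos_of_nonneg hr0 s.coe_nonneg)]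
        exact zero_le
      by_contra hcon
      have hev := ((hcont.tendsto r).eventually (lt_mem_nhds (not_le.1 hcon)))
      obtain ⟨r₁, hr₁, hsub⟩ := (mem_nhdsLT_iff_exists_Ioo_subset' hr0).1
        (inter_mem (mem_nhdsWithin_of_mem_nhds hev) (Ioo_mem_nhdsLT hr0))
      obtain ⟨c, hc, hrc, hcr⟩ := hdense.exists_between hr₁
      have h1 := hsub ⟨hrc, hcr⟩
      have h2 := hgood c h1.2.1 (hcr.trans hr) (not_not.1 hc)
      have h3 : M (Set.Iic c) ≤ M (Set.Iic r) := measure_mono (Set.Iic_subset_Iic.2 hcr.le)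
      rw [h2] at h3
      exact absurd h1.1 (not_lt.2 h3)
  rw [← hback, hMs, Measure.map_smul, hℓ, coe_nndist, map_unitSpeed_restrict_Icc h]

end SegmentMeasure

/-! ### Strict convexity, rigidity, and curves along paths. -/

section Main

/-- Since s^{1-p} = s (1/s)^p, this is strict Jensen for r ↦ r^p at the points 1/s_i with weights
proportional to l_i s_i, whose barycentre is 1/s. -/
lemma eq_of_add_rpow_one_sub_le {p l₁ l₂ s₁ s₂ s : ℝ} (hp : 1 < p) (hl₁ : 0 < l₁) (hl₂ : 0 < l₂)
    (hs₁ : 0 < s₁) (hs₂ : 0 < s₂) (hs : 0 < s) (hsum : l₁ * s₁ + l₂ * s₂ = (l₁ + l₂) * s)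
    (hle : l₁ * s₁ ^ (1 - p) + l₂ * s₂ ^ (1 - p) ≤ (l₁ + l₂) * s ^ (1 - p)) : s₁ = s := by
  by_cases h12 : s₁ = s₂
  · subst h12
    rw [← add_mul] at hsum
    exact mul_left_cancel₀ (by positivity) hsum
  exfalso
  have hpow : ∀ t : ℝ, 0 < t → t ^ (1 - p) = t * t⁻¹ ^ p := fun t ht => by
    rw [Real.rpow_sub ht, Real.rpow_one, Real.inv_rpow ht.le, div_eq_mul_inv]
  have hne : s₁⁻¹ ≠ s₂⁻¹ := fun h => h12 (inv_injective h)
  have hw₁ : 0 < l₁ * s₁ / ((l₁ + l₂) * s) := by positivity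
  have hw₂ : 0 < l₂ * s₂ / ((l₁ + l₂) * s) := by positivity
  have hi₁ : s₁⁻¹ ∈ Set.Ici (0 : ℝ) := Set.mem_Ici.2 (by positivity)
  have hi₂ : s₂⁻¹ ∈ Set.Ici (0 : ℝ) := Set.mem_Ici.2 (by positivity)
  have hc := (strictConvexOn_rpow hp).2 hi₁ hi₂ hne hw₁ hw₂
    (by rw [← add_div, hsum, div_self (by positivity)])
  simp only [smul_eq_mul] at hc
  have e1 : l₁ * s₁ / ((l₁ + l₂) * s) * s₁⁻¹ + l₂ * s₂ / ((l₁ + l₂) * s) * s₂⁻¹ = s⁻¹ := by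
    field_simp
  rw [hpow s₁ hs₁, hpow s₂ hs₂, hpow s hs] at hle
  rw [e1] at hc
  have e2 : l₁ * s₁ / ((l₁ + l₂) * s) * s₁⁻¹ ^ p + l₂ * s₂ / ((l₁ + l₂) * s) * s₂⁻¹ ^ p =
      (l₁ * (s₁ * s₁⁻¹ ^ p) + l₂ * (s₂ * s₂⁻¹ ^ p)) / ((l₁ + l₂) * s) := by ring
  rw [e2, lt_div_iff₀ (by positivity)] at hc
  linarith

lemma eq_of_add_rpow_one_sub_le_ennreal {p : ℝ} {l₁ l₂ s₁ s₂ s : ℝ≥0} (hp : 1 < p) (hl₁ : l₁ ≠ 0)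
    (hl₂ : l₂ ≠ 0) (hs : s ≠ 0) (hsum : l₁ * s₁ + l₂ * s₂ = (l₁ + l₂) * s)
    (hle : (l₁ : ℝ≥0∞) * (s₁ : ℝ≥0∞) ^ (1 - p) + l₂ * (s₂ : ℝ≥0∞) ^ (1 - p) ≤
      (l₁ + l₂ : ℝ≥0) * (s : ℝ≥0∞) ^ (1 - p)) : s₁ = s := by
  have hneg : 1 - p < 0 := by linarith
  rw [← ENNReal.coe_rpow_of_ne_zero hs, ← ENNReal.coe_mul] at hle
  have hs₁ : s₁ ≠ 0 := by
    rintro rfl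
    refine ENNReal.coe_ne_top (top_le_iff.1 (le_trans (le_of_eq ?_) hle))
    simp [ENNReal.zero_rpow_of_neg hneg, hl₁]
  have hs₂ : s₂ ≠ 0 := by
    rintro rfl
    refine ENNReal.coe_ne_top (top_le_iff.1 (le_trans (le_of_eq ?_) hle))
    simp [ENNReal.zero_rpow_of_neg hneg, hl₂]
  rw [← ENNReal.coe_rpow_of_ne_zero hs₁, ← ENNReal.coe_rpow_of_ne_zero hs₂, ← ENNReal.coe_mul,
    ← ENNReal.coe_mul, ← ENNReal.coe_add, ENNReal.coe_le_coe] at hle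
  have hpos : ∀ {t : ℝ≥0}, t ≠ 0 → (0 : ℝ) < t := fun ht => by
    exact_mod_cast pos_iff_ne_zero.2 ht
  exact NNReal.coe_injective (eq_of_add_rpow_one_sub_le hp (hpos hl₁) (hpos hl₂) (hpos hs₁)
    (hpos hs₂) (hpos hs) (by exact_mod_cast hsum) (by exact_mod_cast hle))

namespace SlopeSystem

variable {X : Type*} [MetricSpace X] [MeasurableSpace X] [BorelSpace X]
  [SecondCountableTopology X] {T : Set X} {x y : X} {ι : Type*} [Fintype ι]

/-- If the lower bound is attained, then the mass of each piece is spread evenly. -/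
theorem measure_inter_preimage_Iic_of_rpow_eq (S : SlopeSystem T x y ι) (hT : IsCompact T)
    {μ : Measure X} [IsFiniteMeasure μ] (hμT : μ Tᶜ = 0) (hy : y ∈ T) (hx : x ∈ T) {p : ℝ}
    (hp : 1 < p) (hlen : ∀ i, S.len i ≠ 0) (s : ι → ℝ≥0) (hs0 : ∀ i, s i ≠ 0)
    (hs : ∀ i, μ (S.piece i) = S.len i * s i)
    {W : ℝ≥0∞} (hW : IsCondWasserstein p (Measure.dirac x) (Measure.dirac y) μ W)
    (heq : W ^ p = ∑ i, (S.len i : ℝ≥0∞) * (s i : ℝ≥0∞) ^ (1 - p)) (i₀ : ι) {l : ℝ≥0}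
    (hl0 : 0 < l) (hl : l < S.len i₀)
    (hnull : μ (S.piece i₀ ∩ S.pot i₀ ⁻¹' {(l : ℝ)}) = 0) :
    μ (S.piece i₀ ∩ S.pot i₀ ⁻¹' Set.Iic (l : ℝ)) = l * s i₀ := by
  classical
  set S' := S.split i₀ l hl.le with hS'
  set E₁ := S.piece i₀ ∩ S.pot i₀ ⁻¹' Set.Iic (l : ℝ) with hE₁
  set E₂ := S.piece i₀ ∩ S.pot i₀ ⁻¹' Set.Ici (l : ℝ) with hE₂
  have hp₁ : S'.piece (some i₀) = E₁ := if_pos rfl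
  have hp₂ : S'.piece none = E₂ := rfl
  set l₂ := S.len i₀ - l with hl₂
  have hl₂0 : l₂ ≠ 0 := (tsub_pos_of_lt hl).ne'
  have hlen_add : l + l₂ = S.len i₀ := add_tsub_cancel_of_le hl.le
  set s₁ := (μ E₁).toNNReal / l with hs₁
  set s₂ := (μ E₂).toNNReal / l₂ with hs₂
  have hm₁ : μ E₁ = l * s₁ := by
    rw [hs₁, ← ENNReal.coe_mul, mul_div_cancel₀ _ hl0.ne',
      ENNReal.coe_toNNReal (measure_ne_top _ _)]
  have hm₂ : μ E₂ = l₂ * s₂ := by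
    rw [hs₂, ← ENNReal.coe_mul, mul_div_cancel₀ _ hl₂0,
      ENNReal.coe_toNNReal (measure_ne_top _ _)]
  have hunion : E₁ ∪ E₂ = S.piece i₀ := by
    rw [hE₁, hE₂, ← Set.inter_union_distrib_left, ← Set.preimage_union, Set.Iic_union_Ici,
      Set.preimage_univ, Set.inter_univ]
  have hinter : E₁ ∩ E₂ = S.piece i₀ ∩ S.pot i₀ ⁻¹' {(l : ℝ)} := by
    rw [hE₁, hE₂, ← Set.inter_inter_distrib_left, ← Set.preimage_inter, Set.Iic_inter_Ici,
      Set.Icc_self]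
  have hE₂m : MeasurableSet E₂ := (hp₂ ▸ S'.isClosed_piece none).measurableSet
  -- The two closed halves overlap in the level set, so their masses add up only because that set is
  -- null.
  have hsum : l * s₁ + l₂ * s₂ = (l + l₂) * s i₀ := by
    have h := measure_union_add_inter E₁ hE₂m (μ := μ)
    rw [hunion, hinter, hnull, add_zero, hs, hm₁, hm₂] at h
    rw [hlen_add]
    exact_mod_cast h.symm
  have key := S'.sum_len_mul_rpow_le hT hμT hy hx hp ?_
    (fun o => o.elim s₂ fun i => if i = i₀ then s₁ else s i) ?_ hW
  · rw [heq, Fintype.sum_option, ← Finset.add_sum_erase _ _ (Finset.mem_univ i₀),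
      ← Finset.add_sum_erase (a := i₀) _ _ (Finset.mem_univ i₀)] at key
    have e1 : ∀ i ∈ Finset.univ.erase i₀,
        (S'.len (some i) : ℝ≥0∞) * (((some i).elim s₂ fun i => if i = i₀ then s₁ else s i :
          ℝ≥0) : ℝ≥0∞) ^ (1 - p) = (S.len i : ℝ≥0∞) * (s i : ℝ≥0∞) ^ (1 - p) := by
      intro i hi
      have hne := Finset.ne_of_mem_erase hi
      have e : S'.len (some i) = S.len i := if_neg hne
      rw [e, Option.elim_some, if_neg hne]
    rw [Finset.sum_congr rfl e1, ← add_assoc] at key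
    have hfin : ∑ i ∈ Finset.univ.erase i₀, (S.len i : ℝ≥0∞) * (s i : ℝ≥0∞) ^ (1 - p) ≠ ⊤ :=
      ENNReal.sum_ne_top.2 fun i _ => by
        rw [← ENNReal.coe_rpow_of_ne_zero (hs0 i)]
        exact ENNReal.mul_ne_top (by simp) (by simp)
    have key2 := (ENNReal.add_le_add_iff_right hfin).1 key
    have e2 : S'.len (some i₀) = l := if_pos rfl
    have e3 : S'.len none = l₂ := rfl
    rw [e2, e3, Option.elim_some, Option.elim_none, if_pos rfl, add_comm, ← hlen_add] at key2
    rw [hm₁, eq_of_add_rpow_one_sub_le_ennreal hp hl0.ne' hl₂0 (hs0 i₀) hsum key2]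
  · rintro (_ | i)
    · exact hl₂0
    · by_cases hi : i = i₀
      · have e : S'.len (some i) = l := if_pos hi
        rw [e]; exact hl0.ne'
      · have e : S'.len (some i) = S.len i := if_neg hi
        rw [e]; exact hlen i
  · rintro (_ | i)
    · exact hm₂
    · by_cases hi : i = i₀
      · have e : S'.len (some i) = l := if_pos hi
        rw [e, hi, hp₁, Option.elim_some, if_pos rfl, hm₁]
      · have e : S'.len (some i) = S.len i := if_neg hi
        have e' : S'.piece (some i) = S.piece i := if_neg hi
        rw [e, e', Option.elim_some, if_neg hi, hs]

end SlopeSystem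

variable {d : ℕ} {T : TreeNetwork d} {x y : EuclideanSpace ℝ (Fin d)}

instance finite_orbit : Finite (T.orbit x y) :=
  (T.finite_edges.subset TreeNetwork.orbit_subset).to_subtype

lemma hausdorffMeasure_edgeSegment (e : Sym2 (EuclideanSpace ℝ (Fin d))) :
    Measure.hausdorffMeasure 1 (edgeSegment e) = (edgeLength e : ℝ≥0∞) := by
  induction e with | _ u v =>
  rw [edgeSegment_mk, hausdorffMeasure_segment, edgeLength_mk, edist_nndist]

lemma IsUniformOnEdge.restrict_eq {μ : Measure (EuclideanSpace ℝ (Fin d))}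
    {e : Sym2 (EuclideanSpace ℝ (Fin d))} (h : IsUniformOnEdge μ e) (hl : edgeLength e ≠ 0)
    {s : ℝ≥0} (hs : μ (edgeSegment e) = edgeLength e * s) :
    μ.restrict (edgeSegment e) = s • (Measure.hausdorffMeasure 1).restrict (edgeSegment e) := by
  obtain ⟨c, hc⟩ := h
  have h1 := congrArg (fun M => M (edgeSegment e)) hc
  simp only [Measure.smul_apply, Measure.restrict_apply_self, hs,
    hausdorffMeasure_edgeSegment] at h1
  have h2 : edgeLength e * s = c * edgeLength e := by
    have h1' : (edgeLength e : ℝ≥0∞) * s = (c : ℝ≥0∞) * edgeLength e := h1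
    exact_mod_cast h1'
  rw [mul_comm] at h2
  rw [hc, mul_right_cancel₀ hl h2]

/-- A path along which the mass is uniformly distributed on each edge is a quantile curve. -/
lemma exists_isQuantileCurve_of_path (μ : Measure (EuclideanSpace ℝ (Fin d)))
    (s : Sym2 (EuclideanSpace ℝ (Fin d)) → ℝ≥0) {p : ℝ} (hp : 0 < p) (q : T.graph.Walk x y)
    (hq : q.IsTrail) (hs : ∀ e ∈ q.edges, s e ≠ 0)
    (hμ : ∀ e ∈ q.edges, μ.restrict (edgeSegment e) =
      s e • (Measure.hausdorffMeasure 1).restrict (edgeSegment e)) :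
    ∃ m Q h, IsQuantileCurve (μ.restrict (⋃ e ∈ q.edges, edgeSegment e)) x y m Q h ∧
      ∫⁻ t, h t ^ p ≤
        (q.edges.map fun e => (edgeLength e : ℝ≥0∞) * (s e : ℝ≥0∞) ^ (1 - p)).sum := by
  induction q with
  | @nil x =>
    refine ⟨0, fun _ => x, 0, ?_, ?_⟩
    · simpa using isQuantileCurve_const x
    · simp [hp]
  | @cons x w y hadj r ih =>
    rw [SimpleGraph.Walk.isTrail_cons] at hq
    simp only [SimpleGraph.Walk.edges_cons, List.mem_cons, forall_eq_or_imp] at hs hμ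
    obtain ⟨m, Q, h, H, hen⟩ := ih hq.1 hs.2 hμ.2
    have hne : x ≠ w := hadj.ne
    have H₁ := isQuantileCurve_segment hne hs.1
    have hμ1 := hμ.1
    rw [edgeSegment_mk] at hμ1
    rw [← hμ1] at H₁
    have hrestrict : μ.restrict (⋃ e ∈ (SimpleGraph.Walk.cons hadj r).edges, edgeSegment e) =
        μ.restrict (segment ℝ x w) + μ.restrict (⋃ e ∈ r.edges, edgeSegment e) := by
      -- The first edge meets the others only in its endpoints, which are null because μ is a
      -- multiple of arc length on that edge.
      have hdisj : AEDisjoint μ (segment ℝ x w) (⋃ e ∈ r.edges, edgeSegment e) := by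
        have hpt : ∀ z ∈ segment ℝ x w, μ {z} = 0 := by
          intro z hz
          have h1 := congrArg (fun M => M {z}) hμ1
          have : NullSingletonClass
              (Measure.hausdorffMeasure 1 : Measure (EuclideanSpace ℝ (Fin d))) :=
            Measure.nullSingletonClass_hausdorff _ zero_lt_one
          simp only [Measure.smul_apply, Measure.restrict_apply (measurableSet_singleton z),
            Set.inter_eq_left.2 (Set.singleton_subset_iff.2 hz), measure_singleton, smul_zero]
            at h1
          exact h1
        refine measure_mono_null (t := {x} ∪ {w}) ?_ (measure_union_null
          (hpt x (left_mem_segment ℝ _ _)) (hpt w (right_mem_segment ℝ _ _)))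
        rintro z ⟨hz, hz'⟩
        obtain ⟨f, hf, hzf⟩ := Set.mem_iUnion₂.1 hz'
        have hfe : s(x, w) ≠ f := fun h => hq.2 (h ▸ hf)
        exact Sym2.mem_iff.1
          (T.embedded _ hadj f (r.edges_subset_edgeSet hf) hfe z ⟨hz, hzf⟩).1
      have hU : MeasurableSet (⋃ e ∈ r.edges, edgeSegment e) := by
        refine MeasurableSet.biUnion (Set.Finite.countable ?_) fun e _ =>
          (isCompact_edgeSegment e).measurableSet
        exact r.edges.finite_toSet
      have hset : (⋃ e ∈ (SimpleGraph.Walk.cons hadj r).edges, edgeSegment e) =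
          segment ℝ x w ∪ ⋃ e ∈ r.edges, edgeSegment e := by
        ext z
        simp [edgeSegment_mk]
      rw [hset, Measure.restrict_union₀ hdisj hU.nullMeasurableSet]
    refine ⟨_, _, _, hrestrict ▸ H₁.concat H, ?_⟩
    rw [SimpleGraph.Walk.edges_cons, List.map_cons, List.sum_cons, edgeLength_mk,
      ← lintegral_speed_segment hs.1 hp, coe_nndist]
    exact lintegral_rpow_concat_le.trans (add_le_add le_rfl hen)

end Main

end GilbertMailing

end

/-! ### Assembly. -/

open GilbertMailing in
theorem mainTheorem2 {d : ℕ} (T : GilbertMailing.TreeNetwork d)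
    (s : Sym2 (EuclideanSpace ℝ (Fin d)) → ℝ≥0)
    (μ : Measure (EuclideanSpace ℝ (Fin d))) [IsProbabilityMeasure μ]
    (hμT : μ T.carrierᶜ = 0)
    (hμs : ∀ e ∈ T.graph.edgeSet,
      μ (GilbertMailing.edgeSegment e) = (GilbertMailing.edgeLength e : ℝ≥0∞) * (s e : ℝ≥0∞))
    (p : ℝ) (hp : 1 < p)
    (x y : EuclideanSpace ℝ (Fin d)) (hxy : T.graph.Reachable x y) :
    ∃ W : ℝ≥0∞,
      GilbertMailing.IsCondWasserstein p (Measure.dirac x) (Measure.dirac y) μ W ∧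
      ∑' e : T.orbit x y,
          (GilbertMailing.edgeLength e.1 : ℝ≥0∞) * (s e.1 : ℝ≥0∞) ^ (1 - p) ≤ W ^ p ∧
      ((∀ e ∈ T.orbit x y, GilbertMailing.IsUniformOnEdge μ e) →
        W ^ p = ∑' e : T.orbit x y,
          (GilbertMailing.edgeLength e.1 : ℝ≥0∞) * (s e.1 : ℝ≥0∞) ^ (1 - p)) ∧
      ((∀ e ∈ T.orbit x y, 0 < s e) →
        W ^ p = ∑' e : T.orbit x y,
          (GilbertMailing.edgeLength e.1 : ℝ≥0∞) * (s e.1 : ℝ≥0∞) ^ (1 - p) →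
        ∀ e ∈ T.orbit x y, GilbertMailing.IsUniformOnEdge μ e) := by
  classical
  have hp0 : 0 < p := by linarith
  have hneg : 1 - p < 0 := by linarith
  have hW := isCondWasserstein_dirac_iSup hp.le x y μ
  set W := ⨆ t : ℝ≥0, (t : ℝ≥0∞)⁻¹ *
    wasserstein p (μ + t • Measure.dirac x) (μ + t • Measure.dirac y) with hWdef
  have := Fintype.ofFinite (T.orbit x y)
  have hlen : ∀ e : T.orbit x y, (T.slopeSystem x y).len e ≠ 0 := fun e =>
    TreeNetwork.edgeLength_ne_zero (TreeNetwork.orbit_subset e.2)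
  have hs : ∀ e : T.orbit x y, μ ((T.slopeSystem x y).piece e) =
      (T.slopeSystem x y).len e * s e.1 := fun e => hμs e.1 (TreeNetwork.orbit_subset e.2)
  have lower : ∑' e : T.orbit x y, (edgeLength e.1 : ℝ≥0∞) * (s e.1 : ℝ≥0∞) ^ (1 - p) ≤
      W ^ p := by
    rw [tsum_fintype]
    -- With an empty orbit the sum is 0, and x need not lie on the network, so the slope system is
    -- used only in the other case.
    rcases (T.orbit x y).eq_empty_or_nonempty with hemp | hne
    · have : IsEmpty (T.orbit x y) := Set.isEmpty_coe_sort.2 hemp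
      simp
    · exact (T.slopeSystem x y).sum_len_mul_rpow_le T.isCompact_carrier hμT
        (TreeNetwork.right_mem_carrier hne) (TreeNetwork.left_mem_carrier hne) hp hlen
        (fun e => s e.1) hs hW
  refine ⟨W, hW, lower, fun hunif => le_antisymm ?_ lower, fun hs0 heq e he => ?_⟩
  -- An edge of zero density makes the right-hand side infinite.
  · by_cases h0 : ∃ e : T.orbit x y, s e.1 = 0
    · obtain ⟨e, he⟩ := h0
      refine le_trans le_top (le_trans (le_of_eq ?_) (ENNReal.le_tsum e))
      rw [he, ENNReal.coe_zero, ENNReal.zero_rpow_of_neg hneg, ENNReal.mul_top]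
      simpa using TreeNetwork.edgeLength_ne_zero (TreeNetwork.orbit_subset e.2)
    push Not at h0
    obtain ⟨q, hq⟩ := hxy.exists_isPath
    have hsub : ∀ e ∈ q.edges, e ∈ T.orbit x y := fun e he => ⟨q, hq, he⟩
    obtain ⟨m, Q, h, H, hen⟩ := exists_isQuantileCurve_of_path μ s hp0 q hq.isTrail
      (fun e he => h0 ⟨e, hsub e he⟩) fun e he => (hunif e (hsub e he)).restrict_eq
        (TreeNetwork.edgeLength_ne_zero (TreeNetwork.orbit_subset (hsub e he)))
        (hμs e (TreeNetwork.orbit_subset (hsub e he)))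
    have hsum : ∫⁻ t, h t ^ p ≤
        ∑' e : T.orbit x y, (edgeLength e.1 : ℝ≥0∞) * (s e.1 : ℝ≥0∞) ^ (1 - p) := by
      refine hen.trans ?_
      rw [← List.sum_toFinset _ hq.isTrail.edges_nodup, ← Finset.tsum_subtype]
      refine ENNReal.tsum_mono_subtype
        (fun e => (edgeLength e : ℝ≥0∞) * (s e : ℝ≥0∞) ^ (1 - p)) ?_
      intro e he
      exact hsub e (List.mem_toFinset.1 he)
    set U := ⋃ e ∈ q.edges, edgeSegment e with hU
    have hUm : MeasurableSet U := by
      refine MeasurableSet.biUnion (Set.Finite.countable ?_) fun e _ =>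
        (isCompact_edgeSegment e).measurableSet
      exact q.edges.finite_toSet
    -- Mass off the path stays in place, and the quantile curve bounds the quotient for every `t`,
    -- hence the supremum.
    have hWle : W ≤ (∫⁻ t, h t ^ p) ^ (1 / p) := by
      refine iSup_le fun t => ?_
      have h1 := wasserstein_add_right_le hp0 (μ.restrict U + t • Measure.dirac x)
        (μ.restrict U + t • Measure.dirac y) (μ.restrict Uᶜ)
      rw [add_right_comm, add_right_comm _ _ (μ.restrict Uᶜ),
        Measure.restrict_add_restrict_compl hUm] at h1
      refine (mul_le_mul_right (h1.trans (H.wasserstein_le hp t)) _).trans ?_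
      rw [← mul_assoc]
      exact mul_le_of_le_one_left' (ENNReal.inv_mul_le_one _)
    refine ((ENNReal.rpow_le_rpow hWle hp0.le).trans (le_of_eq ?_)).trans hsum
    rw [← ENNReal.rpow_mul, one_div_mul_cancel hp0.ne', ENNReal.rpow_one]
  · have hne : (T.orbit x y).Nonempty := ⟨e, he⟩
    rw [tsum_fintype] at heq
    obtain ⟨h1, h2, -⟩ := TreeNetwork.endpoints_spec (⟨e, he⟩ : T.orbit x y)
    set u := (TreeNetwork.endpoints (⟨e, he⟩ : T.orbit x y)).1 with hu
    set v := (TreeNetwork.endpoints (⟨e, he⟩ : T.orbit x y)).2 with hv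
    have he' : e = s(u, v) := h1
    refine ⟨s e, ?_⟩
    have hseg : edgeSegment e = segment ℝ u v := by rw [he', edgeSegment_mk]
    have hlength : edgeLength e = nndist u v := by rw [he', edgeLength_mk]
    rw [hseg]
    refine restrict_segment_eq_smul_hausdorffMeasure h2.ne μ ?_ ?_
    · rw [← hseg, ← hlength]
      exact hμs e (TreeNetwork.orbit_subset he)
    · intro l hl0 hl hnull
      -- On its own edge the potential is the distance to u, so sublevel sets are initial pieces of
      -- the segment.
      have hpot : ∀ A : Set ℝ, (T.slopeSystem x y).piece ⟨e, he⟩ ∩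
          (T.slopeSystem x y).pot ⟨e, he⟩ ⁻¹' A =
          segment ℝ u v ∩ {z | dist z u ∈ A} := by
        intro A
        have hp1 : (T.slopeSystem x y).piece ⟨e, he⟩ = segment ℝ u v := hseg
        rw [hp1]
        ext z
        refine and_congr_right fun hz => ?_
        have : (T.slopeSystem x y).pot ⟨e, he⟩ z = dist z u := TreeNetwork.pos_of_mem hz
        rw [Set.mem_preimage, this]
        rfl
      have := (T.slopeSystem x y).measure_inter_preimage_Iic_of_rpow_eq T.isCompact_carrier hμT
        (TreeNetwork.right_mem_carrier hne) (TreeNetwork.left_mem_carrier hne) hp hlen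
        (fun e => s e.1) (fun e => (hs0 e.1 e.2).ne') hs hW heq ⟨e, he⟩ hl0
        (hl.trans_eq hlength.symm) (by rw [hpot]; exact hnull)
      rw [hpot] at this
      exact this
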